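/- Let $\mathfrak L$ be a finite relational language and let $(\mathcal K,\leqslant)$ be a smooth class of finite $\mathfrak L$-structures: $\mathcal K$ is closed under isomorphism and under substructures (HP) and contains $\emptyset$, and $\leqslant$ is a reflexive, transitive, isomorphism-invariant relation between structures $A\subseteq B$ of $\mathcal K$ such that $\emptyset\leqslant A$ for all $A\in\mathcal K$; $A\subseteq B'\subseteq B$ and $A\leqslant B$ imply $A\leqslant B'$; and $A_1,A_2\subseteq A$ and $A_1\leqslant A$ imply $A_1\cap A_2\leqslant A_2$. For an arbitrary $\mathfrak L$-structure $N$ and a finite substructure $A\subseteq N$, write $A\leqslant N$ if $A\leqslant B$ for every finite substructure $B$ of $N$ containing $A$. A $\leqslant$-embedding of $A\in\mathcal K$ into $N$ is an embedding whose image is $\leqslant N$; let $\binom{N}{A}$ denote the set of all of them. Assume that $(\mathcal K,\leqslant)$ has the $\leqslant$-amalgamation property (AP): for all $\leqslant$-embeddings $\gamma_1:A\to B$, $\gamma_2:A\to C$ between members of $\mathcal K$ there are $D\in\mathcal K$ and $\leqslant$-embeddings $\lambda_1:B\to D$, $\lambda_2:C\to D$ with $\lambda_1\circ\gamma_1=\lambda_2\circ\gamma_2$.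 Let $\mathbf M$ be the $(\mathcal K,\leqslant)$-generic structure, i.e. the countable $\mathfrak L$-structure whose finite substructures are, up to isomorphism, exactly the members of $\mathcal K$; which is a union of a chain $A_0\leqslant A_1\leqslant\cdots$ of members of $\mathcal K$; and such that whenever $A\leqslant\mathbf M$ is finite and $A\leqslant B\in\mathcal K$ there is a $\leqslant$-embedding $B\to\mathbf M$ that is the identity on $A$. Give $\mathrm{Aut}(\mathbf M)$ the topology of pointwise convergence ($\mathbf M$ discrete). A Hausdorff topological group $G$ is amenable if every continuous action of $G$ on a nonempty compact Hausdorff space admits a $G$-invariant Borel probability measure. For $A\in\mathcal K$ let $\langle N\rangle^A$ be the set of finitely supported probability measures on $\binom{N}{A}$, and for $f:\binom{N}{A}\to\mathbb R$ and $\mathtt q\in\langle N\rangle^A$ put $f(\mathtt q)=\sum_\Gamma \mathtt q(\Gamma)f(\Gamma)$. For $A\leqslant B$ in $\mathcal K$ and $\mathtt p\in\langle N\rangle^B$, where $N$ is $\mathbf M$ or a member of $\mathcal K$, let $\langle\mathtt p\rangle^A$ be the set of all $\mathtt q\in\langle N\rangle^A$ for which there is $\mathtt s\in\langle B\rangle^A$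 with $$\mathtt q(\Theta)=\sum_{\Lambda\in\binom{N}{B},\ \Gamma\in\binom{B}{A},\ \Lambda\circ\Gamma=\Theta}\mathtt p(\Lambda)\,\mathtt s(\Gamma)\qquad\text{for all }\Theta\in\tbinom{N}{A}.$$ Theorem. The following are equivalent: 1. $\mathrm{Aut}(\mathbf M)$ has the convex $\leqslant$-Ramsey property with respect to $(\mathcal K,\leqslant)$: for all $A\leqslant B$ in $\mathcal K$ and every $f:\binom{\mathbf M}{A}\to\{0,1\}$ there is $\mathtt p\in\langle\mathbf M\rangle^B$ such that $|f(\mathtt q_1)-f(\mathtt q_2)|\le\frac12$ for all $\mathtt q_1,\mathtt q_2\in\langle\mathtt p\rangle^A$. 2. For all $A\leqslant B$ in $\mathcal K$ there is $C\in\mathcal K$ with $B\leqslant C$ such that for every $f:\binom{C}{A}\to\{0,1\}$ there is $\mathtt p\in\langle C\rangle^B$ with $|f(\mathtt q_1)-f(\mathtt q_2)|\le\frac12$ for all $\mathtt q_1,\mathtt q_2\in\langle\mathtt p\rangle^A$. 3. For all $A\leqslant B$ in $\mathcal K$ and every $\epsilon>0$ there is $C\in\mathcal K$ with $B\leqslant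 C$ such that for every $f:\binom{C}{A}\to[0,1]$ there is $\mathtt p\in\langle C\rangle^B$ with $|f(\mathtt q_1)-f(\mathtt q_2)|\le\epsilon$ for all $\mathtt q_1,\mathtt q_2\in\langle\mathtt p\rangle^A$. 4. For all $A\leqslant B$ in $\mathcal K$, every $\epsilon>0$ and every $n\in\mathbb N$ there is $C\in\mathcal K$ with $B\leqslant C$ such that for all functions $f_i:\binom{C}{A}\to[0,1]$, $i<n$, there is $\mathtt p\in\langle C\rangle^B$ with $|f_i(\mathtt q_1)-f_i(\mathtt q_2)|\le\epsilon$ for all $\mathtt q_1,\mathtt q_2\in\langle\mathtt p\rangle^A$ and all $i<n$. 5. $\mathrm{Aut}(\mathbf M)$ is amenable. -/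

import Mathlib

open CategoryTheory MeasureTheory Convexity
open scoped FirstOrder

universe u v w

/-! ### Amenable topological groups -/

/-- A Hausdorff topological group `G` is amenable if every `G`-flow, i.e. every continuous action of
`G` on a nonempty compact Hausdorff space `X`, has a `G`-invariant Borel probability measure. -/
def IsAmenableGroup (G : Type w) [Group G] [TopologicalSpace G] [IsTopologicalGroup G]
    [T2Space G] : Prop :=
  ∀ (X : Type w) [TopologicalSpace X] [CompactSpace X] [T2Space X] [Nonempty X]
    [MulAction G X] [ContinuousSMul G X] [MeasurableSpace X] [BorelSpace X],
    ∃ μ : Measure X, IsProbabilityMeasure μ ∧ ∀ g : G, μ.map (fun x => g • x) = μ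

/-- The value `f(q) = ∑ q(x) f(x)` of a function `f` on a finitely supported probability
measure `q`. -/
noncomputable def Convexity.StdSimplex.evalAt {X : Type*} (q : StdSimplex ℝ X) (f : X → ℝ) : ℝ :=
  q.weights.sum fun x a => a * f x

namespace FirstOrder.Language

variable {L : Language.{u, v}}

/-! ### The automorphism group with the topology of pointwise convergence -/

section Aut

variable (M : Type w) [L.Structure M]

/-- Automorphisms form a group under composition. -/
instance autGroup : Group (M ≃[L] M) where
  mul g h := g.comp h
  one := Equiv.refl L M
  inv g := g.symm
  mul_assoc _ _ _ := rfl
  one_mul _ := rfl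
  mul_one _ := rfl
  inv_mul_cancel g := by
    ext x
    exact g.symm_apply_apply x

/-- The topology of pointwise convergence on `Aut(M)`, where `M` is discrete. -/
instance autTopology : TopologicalSpace (M ≃[L] M) :=
  TopologicalSpace.induced (fun g : M ≃[L] M => (g : M → M))
    (@Pi.topologicalSpace M (fun _ => M) (fun _ => ⊥))

variable {M}

theorem isOpen_aut_apply_eq (a b : M) : IsOpen {g : M ≃[L] M | g a = b} := by
  let : TopologicalSpace M := ⊥
  have : DiscreteTopology M := ⟨rfl⟩
  have hc : Continuous fun g : M ≃[L] M => g a :=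
    (continuous_apply a).comp continuous_induced_dom
  exact (isOpen_discrete {b}).preimage hc

theorem continuous_to_aut {X : Type*} [TopologicalSpace X] {f : X → (M ≃[L] M)}
    (h : ∀ a b, IsOpen {x | f x a = b}) : Continuous f := by
  let : TopologicalSpace M := ⊥
  have : DiscreteTopology M := ⟨rfl⟩
  refine continuous_induced_rng.2 (continuous_pi fun a => ?_)
  exact continuous_discrete_rng.2 fun b => h a b

instance autIsTopologicalGroup : IsTopologicalGroup (M ≃[L] M) where
  continuous_mul := by
    refine continuous_to_aut fun a b => ?_
    have : {x : (M ≃[L] M) × (M ≃[L] M) | (x.1 * x.2) a = b} =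
        ⋃ c, {g : M ≃[L] M | g c = b} ×ˢ {g : M ≃[L] M | g a = c} := by
      ext x
      simp only [Set.mem_ofPred_eq, Set.mem_iUnion, Set.mem_prod]
      exact ⟨fun h => ⟨x.2 a, h, rfl⟩, fun ⟨c, h1, h2⟩ => by rw [← h1, ← h2]; rfl⟩
    rw [this]
    exact isOpen_iUnion fun c => (isOpen_aut_apply_eq c b).prod (isOpen_aut_apply_eq a c)
  continuous_inv := by
    refine continuous_to_aut fun a b => ?_
    have : {g : M ≃[L] M | g⁻¹ a = b} = {g | g b = a} := by
      ext g
      constructor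
      · rintro rfl
        exact g.apply_symm_apply a
      · rintro rfl
        exact g.symm_apply_apply b
    rw [this]
    exact isOpen_aut_apply_eq b a

instance autT2Space : T2Space (M ≃[L] M) := by
  let : TopologicalSpace M := ⊥
  have : DiscreteTopology M := ⟨rfl⟩
  exact T2Space.of_injective_continuous (f := fun g : M ≃[L] M => (g : M → M))
    DFunLike.coe_injective continuous_induced_dom

end Aut

/-! ### Smooth classes -/

/-- For substructures `S`, `T` of `N`, the substructure `S ∩ T` of the structure `T`. -/
def Substructure.restrictTo {N : Type w} [L.Structure N] (S T : L.Substructure N) :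
    L.Substructure T :=
  S.comap T.subtype.toHom

/-- A smooth class of finite structures: a class `carrier`, closed under isomorphisms and
substructures, with a relation `⩽` between substructures and structures of the class.
`closed B S` means `S ⩽ B`; it is only relevant for `B` in the class. -/
structure SmoothClass (L : Language.{u, v}) where
  carrier : Set (Bundled.{w} L.Structure)
  closed : ∀ (B : Type w) [L.Structure B], L.Substructure B → Prop
  finite : ∀ B ∈ carrier, Finite B
  hereditary : Hereditary carrier
  closed_map : ∀ B ∈ carrier, ∀ C ∈ carrier, ∀ (e : B ≃[L] C) (S : L.Substructure B),
    closed B S → closed C (S.map e.toHom)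
  closed_refl : ∀ B ∈ carrier, closed B ⊤
  closed_trans : ∀ B ∈ carrier, ∀ S T : L.Substructure B, S ≤ T →
    closed T (S.restrictTo T) → closed B T → closed B S
  exists_empty : ∃ E ∈ carrier, IsEmpty E
  closed_empty : ∀ B ∈ carrier, ∀ S : L.Substructure B, IsEmpty S → closed B S
  closed_of_le : ∀ B ∈ carrier, ∀ S T : L.Substructure B, S ≤ T →
    closed B S → closed T (S.restrictTo T)
  closed_inter : ∀ B ∈ carrier, ∀ S T : L.Substructure B,
    closed B S → closed T ((S ⊓ T).restrictTo T)

namespace SmoothClass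

variable (K : SmoothClass.{u, v, w} L)

/-- `S ⩽ N` for a finite substructure `S` of an arbitrary structure `N`: `S ⩽ T` for all finite
substructures `T` of `N` that contain `S`. For `N` in the class this agrees with `K.closed`, see
`SmoothClass.closedIn_iff`. -/
def ClosedIn (N : Type w) [L.Structure N] (S : L.Substructure N) : Prop :=
  Finite S ∧ ∀ T : L.Substructure N, Finite T → S ≤ T → K.closed T (S.restrictTo T)

/-- The set of `⩽`-embeddings of `A` into `N`. -/
def ClosedEmb (A N : Type w) [L.Structure A] [L.Structure N] : Type w :=
  {f : A ↪[L] N // K.ClosedIn N f.toHom.range}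

/-- The `⩽`-amalgamation property. -/
def Amalgamation : Prop :=
  ∀ A ∈ K.carrier, ∀ B ∈ K.carrier, ∀ C ∈ K.carrier,
    ∀ (f : K.ClosedEmb A B) (g : K.ClosedEmb A C),
      ∃ D ∈ K.carrier, ∃ (f' : K.ClosedEmb B D) (g' : K.ClosedEmb C D),
        f'.1.comp f.1 = g'.1.comp g.1

/-- `M` is the `(K, ⩽)`-generic structure: it is countable, its age is `K`, it is the union of an
increasing chain of members of `K` each `⩽`-closed in the next, and it has the extension property
for `⩽`-closed finite substructures. -/
structure IsGeneric (M : Type w) [L.Structure M] : Prop where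
  countable : Countable M
  age_eq : L.age M = K.carrier
  chain : ∃ A : ℕ → L.Substructure M, (∀ i, Finite (A i)) ∧ (∀ i, A i ≤ A (i + 1)) ∧
    (∀ i, K.closed (A (i + 1)) ((A i).restrictTo (A (i + 1)))) ∧ ∀ x : M, ∃ i, x ∈ A i
  extension : ∀ A : L.Substructure M, K.ClosedIn M A → ∀ B ∈ K.carrier, ∀ g : K.ClosedEmb A B,
    ∃ h : K.ClosedEmb B M, ∀ a : A, h.1 (g.1 a) = a

/-! ### The convex Ramsey property -/

variable {K}

/-- For a finitely supported probability measure `p` on the `⩽`-embeddings of `B` into `N`, the set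
of all finitely supported probability measures `q` on the `⩽`-embeddings of `A` into `N` of the form
`q = p · s`, where `s` is one on the `⩽`-embeddings of `A` into `B` and `p · s` is the law of `Λ ∘ Γ`
for independent `Λ ∼ p` and `Γ ∼ s`. The equation is one of measures on all embeddings of
`A` into `N`. -/
def composites {A B N : Type w} [L.Structure A] [L.Structure B] [L.Structure N]
    (p : StdSimplex ℝ (K.ClosedEmb B N)) : Set (StdSimplex ℝ (K.ClosedEmb A N)) :=
  {q | ∃ s : StdSimplex ℝ (K.ClosedEmb A B),
    q.weights.mapDomain Subtype.val =
      p.weights.sum fun Λ a => s.weights.sum fun Γ b => Finsupp.single (Λ.1.comp Γ.1) (a * b)}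

/-- All values `f(q)`, for `q` in `composites p`, differ by at most `ε`. -/
def OscLE {A B N : Type w} [L.Structure A] [L.Structure B] [L.Structure N]
    (p : StdSimplex ℝ (K.ClosedEmb B N)) (f : K.ClosedEmb A N → ℝ) (ε : ℝ) : Prop :=
  ∀ q₁ ∈ composites (A := A) p, ∀ q₂ ∈ composites (A := A) p, |q₁.evalAt f - q₂.evalAt f| ≤ ε

variable (K)

/-- `Aut(M)` has the convex `⩽`-Ramsey property with respect to `(K, ⩽)`. -/
def AutConvexRamsey (M : Type w) [L.Structure M] : Prop :=
  ∀ A ∈ K.carrier, ∀ B ∈ K.carrier, Nonempty (K.ClosedEmb A B) →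
    ∀ f : K.ClosedEmb A M → ℝ, (∀ Γ, f Γ = 0 ∨ f Γ = 1) →
      ∃ p : StdSimplex ℝ (K.ClosedEmb B M), OscLE p f (1 / 2)

/-- The finitary condition for 2-colourings. -/
def ConvexRamsey : Prop :=
  ∀ A ∈ K.carrier, ∀ B ∈ K.carrier, Nonempty (K.ClosedEmb A B) →
    ∃ C ∈ K.carrier, Nonempty (K.ClosedEmb B C) ∧
      ∀ f : K.ClosedEmb A C → ℝ, (∀ Γ, f Γ = 0 ∨ f Γ = 1) →
        ∃ p : StdSimplex ℝ (K.ClosedEmb B C), OscLE p f (1 / 2)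

/-- The finitary condition for `[0,1]`-valued functions. -/
def ConvexRamseyReal : Prop :=
  ∀ A ∈ K.carrier, ∀ B ∈ K.carrier, Nonempty (K.ClosedEmb A B) → ∀ ε : ℝ, 0 < ε →
    ∃ C ∈ K.carrier, Nonempty (K.ClosedEmb B C) ∧
      ∀ f : K.ClosedEmb A C → ℝ, (∀ Γ, f Γ ∈ Set.Icc 0 1) →
        ∃ p : StdSimplex ℝ (K.ClosedEmb B C), OscLE p f ε

/-- The finitary condition for finitely many `[0,1]`-valued functions simultaneously. -/
def ConvexRamseyMulti : Prop :=
  ∀ A ∈ K.carrier, ∀ B ∈ K.carrier, Nonempty (K.ClosedEmb A B) → ∀ ε : ℝ, 0 < ε → ∀ n : ℕ,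
    ∃ C ∈ K.carrier, Nonempty (K.ClosedEmb B C) ∧
      ∀ f : Fin n → K.ClosedEmb A C → ℝ, (∀ i Γ, f i Γ ∈ Set.Icc 0 1) →
        ∃ p : StdSimplex ℝ (K.ClosedEmb B C), ∀ i, OscLE p (f i) ε

/-! ### Basic facts showing that the notions above fit together -/

variable {K}

theorem mem_of_embedding [L.IsRelational] {B : Bundled.{w} L.Structure} (hB : B ∈ K.carrier)
    {A : Type w} [L.Structure A] (f : A ↪[L] B) :
    (⟨A, inferInstance⟩ : Bundled.{w} L.Structure) ∈ K.carrier := by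
  have := K.finite B hB
  have : Finite A := Finite.of_injective f f.injective
  exact K.hereditary B hB ⟨Structure.fg_iff_finite.2 this, ⟨f⟩⟩

theorem mem_of_age [L.IsRelational] {N : Type w} [L.Structure N] (hN : L.age N ⊆ K.carrier)
    (T : L.Substructure N) [Finite T] :
    (⟨T, inferInstance⟩ : Bundled.{w} L.Structure) ∈ K.carrier :=
  hN ⟨Structure.fg_iff_finite.2 inferInstance, ⟨T.subtype⟩⟩

theorem closed_of_equiv {P Q : Type w} [iP : L.Structure P] [iQ : L.Structure Q]
    (hP : (⟨P, iP⟩ : Bundled.{w} L.Structure) ∈ K.carrier)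
    (hQ : (⟨Q, iQ⟩ : Bundled.{w} L.Structure) ∈ K.carrier) (e : P ≃[L] Q)
    {S : L.Substructure P} {S' : L.Substructure Q} (h : ∀ x, x ∈ S ↔ e x ∈ S')
    (hS : K.closed P S) : K.closed Q S' := by
  have := K.closed_map _ hP _ hQ e S hS
  have hSS : S.map e.toHom = S' := by
    ext y
    rw [Substructure.mem_map]
    constructor
    · rintro ⟨x, hx, rfl⟩
      exact (h x).1 hx
    · intro hy
      exact ⟨e.symm y, (h _).2 (by rwa [e.apply_symm_apply]), e.apply_symm_apply y⟩
  exact hSS ▸ this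

/-- For members of the class, the two meanings of `S ⩽ B` agree. -/
theorem closedIn_iff [L.IsRelational] {B : Bundled.{w} L.Structure} (hB : B ∈ K.carrier)
    (S : L.Substructure B) : K.ClosedIn B S ↔ K.closed B S := by
  have := K.finite B hB
  constructor
  · rintro ⟨_, h⟩
    have h1 := h ⊤ inferInstance le_top
    exact closed_of_equiv (mem_of_embedding hB (⊤ : L.Substructure B).subtype) hB
      Substructure.topEquiv (fun x => Iff.rfl) h1
  · intro h
    exact ⟨inferInstance, fun T _ hST => K.closed_of_le B hB S T hST h⟩

/-- Composites of `⩽`-embeddings are `⩽`-embeddings. -/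
theorem closedIn_range_comp [L.IsRelational] {A N : Type w} [L.Structure A] [L.Structure N]
    {B : Bundled.{w} L.Structure} (hB : B ∈ K.carrier) (hN : L.age N ⊆ K.carrier)
    (Λ : K.ClosedEmb B N) (Γ : K.ClosedEmb A B) :
    K.ClosedIn N (Λ.1.comp Γ.1).toHom.range := by
  classical
  obtain ⟨Λ, hΛf, hΛ⟩ := Λ
  obtain ⟨Γ, hΓ⟩ := Γ
  have := K.finite B hB
  have : Finite A := Finite.of_injective Γ Γ.injective
  have hΓ' := (closedIn_iff hB _).1 hΓ
  have hmem : ∀ x, x ∈ (Λ.comp Γ).toHom.range ↔ ∃ a, Λ (Γ a) = x := fun x => Hom.mem_range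
  refine ⟨?_, fun T hT hle => ?_⟩
  · exact Set.finite_range (Λ.comp Γ)
  set R : L.Substructure N := Λ.toHom.range with hR
  set S : L.Substructure N := (Λ.comp Γ).toHom.range with hS
  have hSR : S ≤ R := by
    intro x hx
    obtain ⟨a, rfl⟩ := (hmem x).1 hx
    exact Hom.mem_range.2 ⟨Γ a, rfl⟩
  set V : L.Substructure N := Substructure.closure L ((T : Set N) ∪ R) with hV
  have hVf : Finite V := by
    have h1 : (V : Set N) = (T : Set N) ∪ R := Substructure.closure_eq_of_isRelational L _
    have h2 : ((T : Set N) ∪ R).Finite := Set.Finite.union hT hΛf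
    exact (h1 ▸ h2 : (V : Set N).Finite)
  have hTV : T ≤ V := fun x hx => Substructure.subset_closure (Or.inl hx)
  have hRV : R ≤ V := fun x hx => Substructure.subset_closure (Or.inr hx)
  have hVm := mem_of_age hN V
  have hRc : K.closed V (R.restrictTo V) := hΛ V hVf hRV
  let j : B ↪[L] V := Λ.codRestrict V fun b => hRV (Hom.mem_range.2 ⟨b, rfl⟩)
  have hj : ∀ b, (j b : N) = Λ b := fun b => rfl
  have hjR : j.toHom.range = R.restrictTo V := by
    ext x
    constructor
    · rintro hx
      obtain ⟨b, rfl⟩ := Hom.mem_range.1 hx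
      exact Hom.mem_range.2 ⟨b, rfl⟩
    · intro hx
      obtain ⟨b, hb⟩ := Hom.mem_range.1 (show (x : N) ∈ R from hx)
      exact Hom.mem_range.2 ⟨b, Subtype.ext hb⟩
  rw [← hjR] at hRc
  have hSc : K.closed V (S.restrictTo V) := by
    refine K.closed_trans _ hVm _ j.toHom.range ?_ ?_ hRc
    · rw [hjR]
      exact fun x hx => hSR hx
    · refine closed_of_equiv hB (mem_of_embedding hVm (Substructure.subtype _)) j.equivRange
        (fun b => ?_) hΓ'
      constructor
      · intro hb
        obtain ⟨a, rfl⟩ := Hom.mem_range.1 hb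
        exact (hmem _).2 ⟨a, rfl⟩
      · intro hb
        obtain ⟨a, ha⟩ := (hmem _).1 (show (Λ b : N) ∈ S from hb)
        exact Hom.mem_range.2 ⟨a, Λ.injective ha⟩
  have hTc := K.closed_of_le _ hVm (S.restrictTo V) (T.restrictTo V) (fun x hx => hle hx) hSc
  let k : T ↪[L] V := Substructure.inclusion hTV
  have hk : k.toHom.range = T.restrictTo V := by
    ext x
    constructor
    · rintro hx
      obtain ⟨b, rfl⟩ := Hom.mem_range.1 hx
      exact b.2
    · intro hx
      exact Hom.mem_range.2 ⟨⟨x, hx⟩, rfl⟩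
  rw [← hk] at hTc
  refine closed_of_equiv (mem_of_embedding hVm (Substructure.subtype _)) (mem_of_age hN T)
    k.equivRange.symm (fun y => ?_) hTc
  obtain ⟨t, rfl⟩ : ∃ t, k.equivRange t = y := ⟨k.equivRange.symm y, k.equivRange.apply_symm_apply y⟩
  rw [k.equivRange.symm_apply_apply]
  exact Iff.rfl

end SmoothClass

end FirstOrder.Language

namespace FirstOrder.Language.SmoothClass

variable {L : Language.{u, v}} {K : SmoothClass.{u, v, w} L}

/-! ### Calculus of closed embeddings -/

section ClosedEmb

variable {A B N : Type w} [L.Structure A] [L.Structure B] [L.Structure N]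

/-! By `oscLE_iff`, `OscLE p f ε` says that the averaged function Γ ↦ E f(Λ ∘ Γ), Λ ∼ p, oscillates
by at most ε on the closed embeddings A → B. Averages compose (`average_compose`), so good measures
can be chained. The conditions are proved in a cycle.

1 → 2 is compactness: bad colourings of the members of the chain have an ultralimit on M, and a
finitely supported p good for the limit sees only finitely many values. 2 → 3 rounds f to two
colours, which gives oscillation 3/4, then rescales the averaged function and iterates. 3 → 4 treats
one function at a time, since further averaging never increases an oscillation.

For 4 → 5, a function on Aut(M) nearly constant on left cosets of the stabilizer of A is nearly a
function of closed embeddings A → M. The Ramsey condition and homogeneity (`IsGeneric.exists_aut`)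
give means nearly invariant under finitely many translations; on a flow these become nearly
invariant measures, and weak compactness an invariant one.

For 5 → 1, the orbit closure of f is a flow. Integrating coordinates against an invariant measure
gives a function constant on orbits, and finite averages of translates of f approximate it on any
finite set. By homogeneity all closed embeddings A → M lie in one orbit. -/

theorem ClosedEmb.ext {Γ Γ' : K.ClosedEmb A N} (h : ∀ a, Γ.1 a = Γ'.1 a) : Γ = Γ' :=
  Subtype.ext (Embedding.ext h)

theorem range_inclusion {S T : L.Substructure N} (h : S ≤ T) :
    (Substructure.inclusion h).toHom.range = S.restrictTo T := by
  ext x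
  constructor
  · rintro hx
    obtain ⟨b, rfl⟩ := Hom.mem_range.1 hx
    exact b.2
  · intro hx
    exact Hom.mem_range.2 ⟨⟨x, hx⟩, rfl⟩

/-- The equivalence between `T` and its copy inside a larger substructure. -/
noncomputable def equivRestrictTo {T U : L.Substructure N} (h : T ≤ U) :
    T.restrictTo U ≃[L] T where
  toFun x := ⟨x.1.1, x.2⟩
  invFun x := ⟨⟨x.1, h x.2⟩, x.2⟩
  left_inv _ := rfl
  right_inv _ := rfl
  map_fun' _ _ := rfl
  map_rel' _ _ := Iff.rfl

variable [L.IsRelational]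

theorem closed_restrictTo_of_le (hN : L.age N ⊆ K.carrier) {S T U : L.Substructure N} [Finite U]
    (hST : S ≤ T) (hTU : T ≤ U) (h : K.closed U (S.restrictTo U)) :
    K.closed T (S.restrictTo T) := by
  have hfT : Finite T := Finite.of_injective _ (Substructure.inclusion hTU).injective
  have hU := mem_of_age hN U
  have h1 := K.closed_of_le _ hU (S.restrictTo U) (T.restrictTo U) (fun x hx => hST hx) h
  exact closed_of_equiv (mem_of_embedding hU (Substructure.subtype _)) (mem_of_age hN T)
    (equivRestrictTo hTU) (fun x => Iff.rfl) h1

/-- Composition of closed embeddings. -/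
noncomputable def ClosedEmb.comp (hB : (⟨B, inferInstance⟩ : Bundled.{w} L.Structure) ∈ K.carrier)
    (hN : L.age N ⊆ K.carrier) (Λ : K.ClosedEmb B N) (Γ : K.ClosedEmb A B) : K.ClosedEmb A N :=
  ⟨Λ.1.comp Γ.1, closedIn_range_comp hB hN Λ Γ⟩

/-- A closed embedding into `N` is a closed embedding into every finite substructure that
contains its range. -/
noncomputable def ClosedEmb.codRestrict (hN : L.age N ⊆ K.carrier) (T : L.Substructure N) [Finite T]
    (Λ : K.ClosedEmb B N) (h : ∀ b, Λ.1 b ∈ T) : K.ClosedEmb B T :=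
  ⟨Λ.1.codRestrict T h, by
    refine (closedIn_iff (mem_of_age hN T) _).2 ?_
    have hle : Λ.1.toHom.range ≤ T := by
      intro x hx
      obtain ⟨b, rfl⟩ := Hom.mem_range.1 hx
      exact h b
    have key : (Λ.1.codRestrict T h).toHom.range = Λ.1.toHom.range.restrictTo T := ?_
    · exact key ▸ Λ.2.2 T inferInstance hle
    ext x
    constructor
    · intro hx
      obtain ⟨b, rfl⟩ := Hom.mem_range.1 hx
      exact Hom.mem_range.2 ⟨b, rfl⟩
    · intro hx
      obtain ⟨b, hb⟩ := Hom.mem_range.1 (show (x : N) ∈ Λ.1.toHom.range from hx)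
      exact Hom.mem_range.2 ⟨b, Subtype.ext hb⟩⟩

/-- The inclusion of a closed substructure. -/
noncomputable def ClosedIn.subtype {S : L.Substructure N} (h : K.ClosedIn N S) : K.ClosedEmb S N :=
  ⟨S.subtype, by rwa [Substructure.range_subtype]⟩

/-- Closedness is tested on finite T; pull T back along g and use isomorphism invariance. -/
theorem ClosedIn.map_equiv (hN : L.age N ⊆ K.carrier) (g : N ≃[L] N) {S S' : L.Substructure N}
    (hS : K.ClosedIn N S) (h : ∀ x, x ∈ S ↔ g x ∈ S') : K.ClosedIn N S' := by
  have hmap : S.map g.toHom = S' := by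
    ext y
    rw [Substructure.mem_map]
    constructor
    · rintro ⟨x, hx, rfl⟩
      exact (h x).1 hx
    · intro hy
      exact ⟨g.symm y, (h _).2 (by rwa [g.apply_symm_apply]), g.apply_symm_apply y⟩
  have := hS.1
  subst hmap
  refine ⟨?_, fun T hT hle => ?_⟩
  · exact Set.Finite.image _ (Set.toFinite (S : Set N))
  have hfin : Finite (T.comap g.toHom) :=
    Set.Finite.preimage (f := g) g.injective.injOn (Set.toFinite (T : Set N))
  let e : T.comap g.toHom ≃[L] T :=
    { toFun := fun x => ⟨g x.1, x.2⟩
      invFun := fun y => ⟨g.symm y.1, show g (g.symm y.1) ∈ T by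
        rw [g.apply_symm_apply]; exact y.2⟩
      left_inv := fun x => Subtype.ext (g.symm_apply_apply x.1)
      right_inv := fun x => Subtype.ext (g.apply_symm_apply x.1)
      map_fun' := fun f => isEmptyElim f
      map_rel' := fun r x => g.map_rel r fun i => (x i : N) }
  exact closed_of_equiv (mem_of_age hN _) (mem_of_age hN T) e (fun x => h x.1)
    (hS.2 _ hfin fun x hx => hle ((h x).1 hx))

end ClosedEmb

theorem age_subset_of_mem {C : Bundled.{w} L.Structure} (hC : C ∈ K.carrier) :
    L.age C ⊆ K.carrier :=
  K.hereditary C hC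

/-! ### The generic structure -/

section Generic

variable {M : Type w} [L.Structure M]

theorem IsGeneric.age_subset (hM : K.IsGeneric M) : L.age M ⊆ K.carrier := hM.age_eq.le

variable [L.IsRelational]

/-- Transitivity upgrades closedness of consecutive links to all pairs i ≤ j. Every finite T lies in
some link, so closedness there restricts to T. -/
theorem IsGeneric.exists_chain (hM : K.IsGeneric M) : ∃ A : ℕ → L.Substructure M,
    (∀ i, Finite (A i)) ∧ Monotone A ∧ (∀ i, K.ClosedIn M (A i)) ∧
      ∀ F : Set M, F.Finite → ∃ i, F ⊆ A i := by
  obtain ⟨A, hfin, hle, hcl, hex⟩ := hM.chain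
  have hmono : Monotone A := monotone_nat_of_le_succ hle
  have hcov : ∀ F : Set M, F.Finite → ∃ i, F ⊆ A i := by
    intro F hF
    choose k hk using hex
    obtain ⟨m, hm⟩ := (hF.image k).bddAbove
    exact ⟨m, fun x hx => hmono (hm ⟨x, hx, rfl⟩) (hk x)⟩
  have hij : ∀ i j (h : i ≤ j), K.ClosedIn (A j) (Substructure.inclusion (hmono h)).toHom.range := by
    intro i j h
    induction j, h using Nat.le_induction with
    | base =>
      rw [closedIn_iff (mem_of_age hM.age_subset (A i))]
      have h1 : (Substructure.inclusion (hmono (le_refl i))).toHom.range = ⊤ := by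
        rw [range_inclusion]
        exact top_le_iff.1 fun x _ => x.2
      exact h1 ▸ K.closed_refl _ (mem_of_age hM.age_subset (A i))
    | succ j h ih =>
      have h2 : K.ClosedIn (A (j + 1)) (Substructure.inclusion (hle j)).toHom.range := by
        rw [closedIn_iff (mem_of_age hM.age_subset (A (j + 1))), range_inclusion]
        exact hcl j
      exact closedIn_range_comp (B := ⟨A j, inferInstance⟩) (mem_of_age hM.age_subset (A j))
        (age_subset_of_mem (mem_of_age hM.age_subset (A (j + 1)))) ⟨_, h2⟩ ⟨_, ih⟩
  refine ⟨A, hfin, hmono, fun i => ⟨hfin i, fun T hT hiT => ?_⟩, hcov⟩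
  obtain ⟨j, hj⟩ := hcov T (Set.toFinite _)
  have hj' : i ≤ max i j := le_max_left _ _
  have := (closedIn_iff (mem_of_age hM.age_subset (A _)) _).1 (hij i _ hj')
  rw [range_inclusion] at this
  exact closed_restrictTo_of_le hM.age_subset hiT (fun x hx => hmono (le_max_right i j) (hj hx)) this

theorem IsGeneric.exists_closedIn (hM : K.IsGeneric M) {F : Set M} (hF : F.Finite) :
    ∃ S : L.Substructure M, K.ClosedIn M S ∧ F ⊆ S := by
  obtain ⟨A, -, -, hcl, hcov⟩ := hM.exists_chain
  obtain ⟨i, hi⟩ := hcov F hF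
  exact ⟨A i, hcl i, hi⟩

/-- The empty structure is closed in both B and M, so the extension property applies over it. -/
theorem IsGeneric.nonempty_closedEmb (hM : K.IsGeneric M) {B : Type w} [L.Structure B]
    (hB : (⟨B, inferInstance⟩ : Bundled.{w} L.Structure) ∈ K.carrier) :
    Nonempty (K.ClosedEmb B M) := by
  -- Any embedding `e`, closed or not, is needed only to make B and M agree on nullary relations.
  obtain ⟨e⟩ : Nonempty (B ↪[L] M) := ((hM.age_eq.symm ▸ hB :
    (⟨B, inferInstance⟩ : Bundled.{w} L.Structure) ∈ L.age M)).2
  have hbot : IsEmpty (⊥ : L.Substructure M) := inferInstance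
  have hcl : K.ClosedIn M ⊥ := ⟨inferInstance, fun T hT _ =>
    K.closed_empty _ (mem_of_age hM.age_subset T) _ ⟨fun x => hbot.false ⟨x.1.1, x.2⟩⟩⟩
  let i : (⊥ : L.Substructure M) ↪[L] B :=
    { toFun := isEmptyElim
      inj' := fun x => isEmptyElim x
      map_fun' := fun f => isEmptyElim f
      map_rel' := fun {n} r x => by
        rw [← e.map_rel]
        have : (e ∘ (isEmptyElim : (⊥ : L.Substructure M) → B) ∘ x) = fun k => (x k : M) :=
          funext fun k => isEmptyElim (x k)
        change Structure.RelMap r (e ∘ (isEmptyElim : (⊥ : L.Substructure M) → B) ∘ x) ↔ _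
        rw [this]
        rfl }
  have hi : K.ClosedIn B i.toHom.range := by
    rw [closedIn_iff hB]
    refine K.closed_empty _ hB _ ⟨fun x => ?_⟩
    obtain ⟨y, -⟩ := Hom.mem_range.1 x.2
    exact hbot.false y
  obtain ⟨h, -⟩ := hM.extension ⊥ hcl _ hB ⟨i, hi⟩
  exact ⟨h⟩

variable (K M) in
/-- Partial isomorphisms between finite closed substructures. -/
abbrev ClosedPartialEquiv : Type w :=
  {f : M ≃ₚ[L] M // K.ClosedIn M f.dom ∧ K.ClosedIn M f.cod}

/-- The "forth" step: the inverse of f embeds its codomain in a closed S containing m, and the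
extension property over that codomain maps S back into M, extending f. -/
theorem IsGeneric.exists_le_mem_dom (hM : K.IsGeneric M) (f : K.ClosedPartialEquiv M) (m : M) :
    ∃ g : K.ClosedPartialEquiv M, m ∈ g.1.dom ∧ f ≤ g := by
  obtain ⟨f, hd, hc⟩ := f
  have := hd.1
  obtain ⟨S, hS, hsub⟩ := hM.exists_closedIn ((Set.toFinite (f.dom : Set M)).insert m)
  have := hS.1
  have hdS : f.dom ≤ S := fun x hx => hsub (Or.inr hx)
  let Λ : K.ClosedEmb f.cod M := ⟨f.dom.subtype.comp f.toEquiv.symm.toEmbedding, by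
    convert hd
    ext x
    constructor
    · intro hx
      obtain ⟨y, rfl⟩ := Hom.mem_range.1 hx
      exact (f.toEquiv.symm y).2
    · intro hx
      exact Hom.mem_range.2 ⟨f.toEquiv ⟨x, hx⟩,
        congrArg Subtype.val (f.toEquiv.symm_apply_apply ⟨x, hx⟩)⟩⟩
  obtain ⟨h, hh⟩ := hM.extension f.cod hc _ (mem_of_age hM.age_subset S)
    (Λ.codRestrict hM.age_subset S fun b => hdS (f.toEquiv.symm b).2)
  refine ⟨⟨⟨S, h.1.toHom.range, h.1.equivRange⟩, hS, h.2⟩, hsub (Or.inl rfl), hdS, ?_⟩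
  ext x
  have := hh (f.toEquiv x)
  change h.1 _ = _
  refine Eq.trans (congrArg h.1 (Subtype.ext ?_)) this
  exact congrArg (fun y : f.dom => (y : M)) (f.toEquiv.symm_apply_apply x).symm

theorem IsGeneric.exists_le_mem_cod (hM : K.IsGeneric M) (f : K.ClosedPartialEquiv M) (m : M) :
    ∃ g : K.ClosedPartialEquiv M, m ∈ g.1.cod ∧ f ≤ g := by
  obtain ⟨g, h1, h2⟩ := hM.exists_le_mem_dom ⟨f.1.symm, f.2.2, f.2.1⟩ m
  exact ⟨⟨g.1.symm, g.2.2, g.2.1⟩, h1, PartialEquiv.monotone_symm h2⟩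

/-- Homogeneity of the generic structure, by a back-and-forth argument. -/
theorem IsGeneric.exists_aut (hM : K.IsGeneric M) {A : Type w} [L.Structure A]
    (Γ Γ' : K.ClosedEmb A M) : ∃ g : M ≃[L] M, ∀ a, g (Γ.1 a) = Γ'.1 a := by
  have := hM.countable
  have _ : Encodable M := Encodable.ofCountable _
  let f₀ : K.ClosedPartialEquiv M := ⟨⟨Γ.1.toHom.range, Γ'.1.toHom.range,
    Γ'.1.equivRange.comp Γ.1.equivRange.symm⟩, Γ.2, Γ'.2⟩
  -- One requirement per point of M for the domain and one for the codomain. They are countably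
  -- many, and the one with code k is met at index k + 1.
  let D : M ⊕ M → Order.Cofinal (K.ClosedPartialEquiv M) := fun p => Sum.recOn p
    (fun x => ⟨{f | x ∈ f.1.dom}, fun f => hM.exists_le_mem_dom f x⟩)
    (fun y => ⟨{f | y ∈ f.1.cod}, fun f => hM.exists_le_mem_cod f y⟩)
  let S : ℕ →o M ≃ₚ[L] M :=
    ⟨Subtype.val ∘ Order.sequenceOfCofinals f₀ D,
      (Subtype.mono_coe _).comp (Order.sequenceOfCofinals.monotone _ _)⟩
  let F := DirectLimit.partialEquivLimit S
  have hdom : F.dom = ⊤ := by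
    refine top_le_iff.1 fun x _ => ?_
    have := Order.sequenceOfCofinals.encode_mem f₀ D (Sum.inl x)
    exact PartialEquiv.dom_le_dom
      (DirectLimit.le_partialEquivLimit S (Encodable.encode (Sum.inl x : M ⊕ M) + 1)) this
  have hcod : F.cod = ⊤ := by
    refine top_le_iff.1 fun x _ => ?_
    have := Order.sequenceOfCofinals.encode_mem f₀ D (Sum.inr x)
    exact PartialEquiv.cod_le_cod
      (DirectLimit.le_partialEquivLimit S (Encodable.encode (Sum.inr x : M ⊕ M) + 1)) this
  refine ⟨PartialEquiv.toEquivOfEqTop hdom hcod, fun a => ?_⟩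
  have h0 : f₀.1 ≤ F := DirectLimit.le_partialEquivLimit S 0
  have h1 := congrArg Subtype.val (PartialEquiv.toEquiv_inclusion_apply h0 (Γ.1.equivRange a))
  have h2 : f₀.1.toEquiv (Γ.1.equivRange a) = Γ'.1.equivRange a :=
    congrArg Γ'.1.equivRange (Γ.1.equivRange.symm_apply_apply a)
  rw [h2] at h1
  have h3 := congrArg (fun e : M ↪[L] M => e (Γ.1 a))
    (PartialEquiv.toEquivOfEqTop_toEmbedding hdom hcod)
  exact h3.trans ((PartialEquiv.toEmbeddingOfEqTop_apply hdom _).trans h1)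

end Generic

end FirstOrder.Language.SmoothClass

/-! ### Expectations with respect to finitely supported probability measures -/

namespace Convexity.StdSimplex

variable {X Y : Type*}

theorem evalAt_single (x : X) (f : X → ℝ) : (single (R := ℝ) x).evalAt f = f x := by
  simp [evalAt]

theorem evalAt_map (p : StdSimplex ℝ X) (g : X → Y) (f : Y → ℝ) :
    (p.map g).evalAt f = p.evalAt fun x => f (g x) := by
  simp [evalAt, Finsupp.sum_mapDomain_index, add_mul]

theorem evalAt_iConvexComb (p : StdSimplex ℝ X) (k : X → StdSimplex ℝ Y) (f : Y → ℝ) :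
    (p.iConvexComb k).evalAt f = p.evalAt fun x => (k x).evalAt f := by
  rw [iConvexComb, evalAt, weights_sConvexComb, weights_map,
    Finsupp.sum_mapDomain_index (by simp) (by simp [add_smul])]
  simp [evalAt, Finsupp.sum_sum_index, Finsupp.sum_smul_index, add_mul, Finsupp.mul_sum, mul_assoc]

theorem evalAt_comm (p : StdSimplex ℝ X) (q : StdSimplex ℝ Y) (f : X → Y → ℝ) :
    (p.evalAt fun x => q.evalAt fun y => f x y) = q.evalAt fun y => p.evalAt fun x => f x y := by
  simp only [evalAt, Finsupp.mul_sum]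
  rw [Finsupp.sum_comm]
  refine Finsupp.sum_congr fun y _ => Finsupp.sum_congr fun x _ => ?_
  ring

theorem evalAt_congr (p : StdSimplex ℝ X) {f g : X → ℝ} (h : ∀ x ∈ p.weights.support, f x = g x) :
    p.evalAt f = p.evalAt g :=
  Finsupp.sum_congr fun x hx => by rw [h x hx]

theorem evalAt_mono (p : StdSimplex ℝ X) {f g : X → ℝ} (h : ∀ x, f x ≤ g x) :
    p.evalAt f ≤ p.evalAt g :=
  Finset.sum_le_sum fun x _ => mul_le_mul_of_nonneg_left (h x) (p.weights_nonneg x)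

theorem evalAt_const (p : StdSimplex ℝ X) (c : ℝ) : (p.evalAt fun _ => c) = c := by
  have := p.total
  simp only [evalAt, ← Finsupp.sum_mul, this, one_mul]

theorem evalAt_add (p : StdSimplex ℝ X) (f g : X → ℝ) :
    (p.evalAt fun x => f x + g x) = p.evalAt f + p.evalAt g := by
  simp only [evalAt, mul_add, Finsupp.sum_add]

theorem evalAt_sub (p : StdSimplex ℝ X) (f g : X → ℝ) :
    (p.evalAt fun x => f x - g x) = p.evalAt f - p.evalAt g := by
  simp only [evalAt, mul_sub, Finsupp.sum_sub]

theorem evalAt_const_mul (p : StdSimplex ℝ X) (c : ℝ) (f : X → ℝ) :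
    (p.evalAt fun x => c * f x) = c * p.evalAt f := by
  simp only [evalAt, Finsupp.mul_sum]
  refine Finsupp.sum_congr fun x _ => ?_
  ring

theorem abs_evalAt_sub_le (p : StdSimplex ℝ X) {f g : X → ℝ} {ε : ℝ}
    (h : ∀ x, |f x - g x| ≤ ε) : |p.evalAt f - p.evalAt g| ≤ ε := by
  rw [← evalAt_sub, abs_le]
  constructor
  · rw [← p.evalAt_const (-ε)]
    exact p.evalAt_mono fun x => (abs_le.1 (h x)).1
  · rw [← p.evalAt_const ε]
    exact p.evalAt_mono fun x => (abs_le.1 (h x)).2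

/-- The oscillation of a function bounds the oscillation of its expectations. -/
theorem abs_evalAt_sub_evalAt_le (p q : StdSimplex ℝ X) {f : X → ℝ} {ε : ℝ}
    (h : ∀ x y, |f x - f y| ≤ ε) : |p.evalAt f - q.evalAt f| ≤ ε := by
  have h1 : p.evalAt f = q.evalAt fun _ => p.evalAt f := (q.evalAt_const _).symm
  rw [h1]
  refine q.abs_evalAt_sub_le fun y => ?_
  rw [← p.evalAt_const (f y)]
  exact p.abs_evalAt_sub_le fun x => h x y

end Convexity.StdSimplex

namespace FirstOrder.Language.SmoothClass

variable {L : Language.{u, v}} {K : SmoothClass.{u, v, w} L}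

/-! ### Averages of functions on closed embeddings -/

section Average

variable {A B C N : Type w} [L.Structure A] [L.Structure B] [L.Structure C] [L.Structure N]

theorem OscLE.mono {p : StdSimplex ℝ (K.ClosedEmb B N)} {f : K.ClosedEmb A N → ℝ} {ε δ : ℝ}
    (h : OscLE p f ε) (hεδ : ε ≤ δ) : OscLE p f δ :=
  fun q₁ h₁ q₂ h₂ => (h q₁ h₁ q₂ h₂).trans hεδ

theorem finite_closedEmb [Finite A] [Finite B] : Finite (K.ClosedEmb A B) :=
  Finite.of_injective (fun Γ : K.ClosedEmb A B => (Γ.1 : A → B)) fun _ _ h =>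
    ClosedEmb.ext fun a => congrFun h a

variable [L.IsRelational]

/-- The expectation of `f (Λ ∘ Γ)` for `Λ ∼ p`, as a function of `Γ`. -/
noncomputable def average (hB : (⟨B, inferInstance⟩ : Bundled.{w} L.Structure) ∈ K.carrier)
    (hN : L.age N ⊆ K.carrier) (p : StdSimplex ℝ (K.ClosedEmb B N)) (f : K.ClosedEmb A N → ℝ)
    (Γ : K.ClosedEmb A B) : ℝ :=
  p.evalAt fun Λ => f (Λ.comp hB hN Γ)

/-- Fubini for the independent pair (Λ, Γ). -/
theorem evalAt_of_mem_composites (hB : (⟨B, inferInstance⟩ : Bundled.{w} L.Structure) ∈ K.carrier)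
    (hN : L.age N ⊆ K.carrier) {p : StdSimplex ℝ (K.ClosedEmb B N)} {f : K.ClosedEmb A N → ℝ}
    {q : StdSimplex ℝ (K.ClosedEmb A N)} (hq : q ∈ composites p) :
    ∃ s : StdSimplex ℝ (K.ClosedEmb A B), q.evalAt f = s.evalAt (average hB hN p f) := by
  classical
  obtain ⟨s, hs⟩ := hq
  refine ⟨s, ?_⟩
  -- The equation defining `composites` lives on all embeddings, so f is extended by 0; only closed
  -- embeddings carry mass.
  let F : (A ↪[L] N) → ℝ := fun e =>
    if h : K.ClosedIn N e.toHom.range then f ⟨e, h⟩ else 0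
  have hF : ∀ Γ : K.ClosedEmb A N, F Γ.1 = f Γ := fun Γ => dif_pos Γ.2
  let val : K.ClosedEmb A N → (A ↪[L] N) := fun Γ => Γ.1
  have h1 : q.evalAt f = (q.weights.mapDomain val).sum fun x a => a * F x := by
    rw [Finsupp.sum_mapDomain_index (by simp) (by intros; ring)]
    exact Finsupp.sum_congr fun x _ => by rw [hF]
  have h2 : s.evalAt (average hB hN p f) =
      p.evalAt fun Λ => s.evalAt fun Γ => f (Λ.comp hB hN Γ) :=
    StdSimplex.evalAt_comm _ _ _
  rw [h1, h2, show q.weights.mapDomain val = _ from hs,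
    Finsupp.sum_sum_index (by simp) (by intros; ring)]
  refine Finsupp.sum_congr fun Λ _ => ?_
  have h3 : p.weights Λ * s.evalAt (fun Γ => f (Λ.comp hB hN Γ)) =
      s.weights.sum fun Γ b => p.weights Λ * (b * f (Λ.comp hB hN Γ)) := Finsupp.mul_sum _ _
  rw [Finsupp.sum_sum_index (by simp) (by intros; ring), h3]
  refine Finsupp.sum_congr fun Γ _ => ?_
  rw [Finsupp.sum_single_index (by simp), ← hF (Λ.comp hB hN Γ)]
  exact mul_assoc _ _ _

/-- Take s to be the point mass at Γ. -/
theorem map_comp_mem_composites (hB : (⟨B, inferInstance⟩ : Bundled.{w} L.Structure) ∈ K.carrier)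
    (hN : L.age N ⊆ K.carrier) (p : StdSimplex ℝ (K.ClosedEmb B N)) (Γ : K.ClosedEmb A B) :
    p.map (fun Λ => Λ.comp hB hN Γ) ∈ composites p := by
  refine ⟨StdSimplex.single Γ, ?_⟩
  let val : K.ClosedEmb A N → (A ↪[L] N) := fun Γ => Γ.1
  change (p.map _).weights.mapDomain val = _
  rw [StdSimplex.weights_map, ← Finsupp.mapDomain_comp]
  refine Finsupp.sum_congr fun Λ _ => ?_
  rw [StdSimplex.weights_single, Finsupp.sum_single_index (by simp), mul_one]
  rfl

/-- Values on `composites p` are convex combinations of the averages at single Γ, and each of these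
averages is itself such a value. -/
theorem oscLE_iff (hB : (⟨B, inferInstance⟩ : Bundled.{w} L.Structure) ∈ K.carrier)
    (hN : L.age N ⊆ K.carrier) {p : StdSimplex ℝ (K.ClosedEmb B N)} {f : K.ClosedEmb A N → ℝ}
    {ε : ℝ} : OscLE p f ε ↔
      ∀ Γ₁ Γ₂ : K.ClosedEmb A B, |average hB hN p f Γ₁ - average hB hN p f Γ₂| ≤ ε := by
  constructor
  · intro h Γ₁ Γ₂
    have := h _ (map_comp_mem_composites hB hN p Γ₁) _ (map_comp_mem_composites hB hN p Γ₂)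
    rwa [StdSimplex.evalAt_map, StdSimplex.evalAt_map] at this
  · intro h q₁ h₁ q₂ h₂
    obtain ⟨s₁, hs₁⟩ := evalAt_of_mem_composites hB hN (f := f) h₁
    obtain ⟨s₂, hs₂⟩ := evalAt_of_mem_composites hB hN (f := f) h₂
    rw [hs₁, hs₂]
    exact s₁.abs_evalAt_sub_evalAt_le s₂ h

/-- The law of `Λ ∘ Θ` for independent `Λ ∼ p₁` and `Θ ∼ p₂`. -/
noncomputable def compose (hC : (⟨C, inferInstance⟩ : Bundled.{w} L.Structure) ∈ K.carrier)
    (hN : L.age N ⊆ K.carrier) (p₁ : StdSimplex ℝ (K.ClosedEmb C N))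
    (p₂ : StdSimplex ℝ (K.ClosedEmb B C)) : StdSimplex ℝ (K.ClosedEmb B N) :=
  p₁.iConvexComb fun Λ => p₂.map (Λ.comp hC hN)

theorem average_compose (hB : (⟨B, inferInstance⟩ : Bundled.{w} L.Structure) ∈ K.carrier)
    (hC : (⟨C, inferInstance⟩ : Bundled.{w} L.Structure) ∈ K.carrier)
    (hN : L.age N ⊆ K.carrier) (p₁ : StdSimplex ℝ (K.ClosedEmb C N))
    (p₂ : StdSimplex ℝ (K.ClosedEmb B C)) (f : K.ClosedEmb A N → ℝ) :
    average hB hN (compose hC hN p₁ p₂) f =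
      average hB (age_subset_of_mem hC) p₂ (average hC hN p₁ f) := by
  funext Γ
  rw [average, compose, StdSimplex.evalAt_iConvexComb]
  simp only [StdSimplex.evalAt_map]
  rw [StdSimplex.evalAt_comm]
  rfl

/-- The new average at Γ is a mean over Θ of the old averages at Θ ∘ Γ, which all lie within the old
bounds. -/
theorem OscLE.compose_left (hB : (⟨B, inferInstance⟩ : Bundled.{w} L.Structure) ∈ K.carrier)
    (hC : (⟨C, inferInstance⟩ : Bundled.{w} L.Structure) ∈ K.carrier)
    (hN : L.age N ⊆ K.carrier) {p₁ : StdSimplex ℝ (K.ClosedEmb C N)}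
    (p₂ : StdSimplex ℝ (K.ClosedEmb B C)) {f : K.ClosedEmb A N → ℝ} {ε : ℝ} (h : OscLE p₁ f ε) :
    OscLE (compose hC hN p₁ p₂) f ε := by
  rw [oscLE_iff hB hN, average_compose hB]
  rw [oscLE_iff hC hN] at h
  exact fun Γ₁ Γ₂ => p₂.abs_evalAt_sub_le fun Θ => h _ _

theorem OscLE.compose_right (hB : (⟨B, inferInstance⟩ : Bundled.{w} L.Structure) ∈ K.carrier)
    (hC : (⟨C, inferInstance⟩ : Bundled.{w} L.Structure) ∈ K.carrier)
    (hN : L.age N ⊆ K.carrier) {p₁ : StdSimplex ℝ (K.ClosedEmb C N)}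
    {p₂ : StdSimplex ℝ (K.ClosedEmb B C)} {f : K.ClosedEmb A N → ℝ} {ε : ℝ}
    (h : OscLE p₂ (average hC hN p₁ f) ε) :
    OscLE (compose hC hN p₁ p₂) f ε := by
  rw [oscLE_iff hB hN, average_compose hB]
  rwa [oscLE_iff hB (age_subset_of_mem hC)] at h

theorem average_mem_Icc (hB : (⟨B, inferInstance⟩ : Bundled.{w} L.Structure) ∈ K.carrier)
    (hN : L.age N ⊆ K.carrier) (p : StdSimplex ℝ (K.ClosedEmb B N)) {f : K.ClosedEmb A N → ℝ}
    {a b : ℝ} (hf : ∀ Γ, f Γ ∈ Set.Icc a b) (Γ : K.ClosedEmb A B) :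
    average hB hN p f Γ ∈ Set.Icc a b := by
  constructor
  · rw [← p.evalAt_const a]
    exact p.evalAt_mono fun Λ => (hf _).1
  · rw [← p.evalAt_const b]
    exact p.evalAt_mono fun Λ => (hf _).2

theorem oscLE_one (hB : (⟨B, inferInstance⟩ : Bundled.{w} L.Structure) ∈ K.carrier)
    (hN : L.age N ⊆ K.carrier) (p : StdSimplex ℝ (K.ClosedEmb B N)) {f : K.ClosedEmb A N → ℝ}
    (hf : ∀ Γ, f Γ ∈ Set.Icc 0 1) : OscLE p f 1 := by
  rw [oscLE_iff hB hN]
  intro Γ₁ Γ₂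
  have h₁ := average_mem_Icc hB hN p hf Γ₁
  have h₂ := average_mem_Icc hB hN p hf Γ₂
  rw [abs_le]
  constructor <;> linarith [h₁.1, h₁.2, h₂.1, h₂.2]

/-- Bounds for the oscillation transfer to all affine images of a function. -/
theorem oscLE_of_affine (hB : (⟨B, inferInstance⟩ : Bundled.{w} L.Structure) ∈ K.carrier)
    (hN : L.age N ⊆ K.carrier) {p : StdSimplex ℝ (K.ClosedEmb B N)} {f g : K.ClosedEmb A N → ℝ}
    {ε c d : ℝ} (hd : 0 ≤ d) (hfg : ∀ Γ, g Γ = c + d * f Γ) (h : OscLE p f ε) :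
    OscLE p g (d * ε) := by
  rw [oscLE_iff hB hN] at h ⊢
  have key : ∀ Γ, average hB hN p g Γ = c + d * average hB hN p f Γ := by
    intro Γ
    simp only [average, hfg]
    rw [StdSimplex.evalAt_add, StdSimplex.evalAt_const, StdSimplex.evalAt_const_mul]
  intro Γ₁ Γ₂
  rw [key, key, show ∀ x y : ℝ, c + d * x - (c + d * y) = d * (x - y) by intros; ring, abs_mul,
    abs_of_nonneg hd]
  exact mul_le_mul_of_nonneg_left (h Γ₁ Γ₂) hd

/-- A bound for the oscillation that holds for `[0,1]`-valued functions scales. -/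
theorem exists_oscLE_mul (hB : (⟨B, inferInstance⟩ : Bundled.{w} L.Structure) ∈ K.carrier)
    (hN : L.age N ⊆ K.carrier) {r : ℝ}
    (h : ∀ f : K.ClosedEmb A N → ℝ, (∀ Γ, f Γ ∈ Set.Icc 0 1) →
      ∃ p : StdSimplex ℝ (K.ClosedEmb B N), OscLE p f r)
    (f : K.ClosedEmb A N → ℝ) {d : ℝ} (hd : 0 < d) (hf : ∀ Γ₁ Γ₂, |f Γ₁ - f Γ₂| ≤ d) :
    ∃ p : StdSimplex ℝ (K.ClosedEmb B N), OscLE p f (d * r) := by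
  -- Oscillation at most d puts the range in [a, a + d] with a the infimum; f is then rescaled to
  -- [0,1].
  obtain ⟨a, ha⟩ : ∃ a, ∀ Γ, f Γ ∈ Set.Icc a (a + d) := by
    rcases isEmpty_or_nonempty (K.ClosedEmb A N) with hE | hE
    · exact ⟨0, fun Γ => isEmptyElim Γ⟩
    · have hb : BddBelow (Set.range f) := by
        obtain ⟨Γ₀⟩ := hE
        refine ⟨f Γ₀ - d, ?_⟩
        rintro _ ⟨Γ, rfl⟩
        linarith [(abs_le.1 (hf Γ₀ Γ)).2]
      refine ⟨⨅ Γ, f Γ, fun Γ => ⟨ciInf_le hb Γ, ?_⟩⟩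
      have : f Γ - d ≤ ⨅ Γ, f Γ := le_ciInf fun Γ' => by linarith [(abs_le.1 (hf Γ Γ')).2]
      linarith
  obtain ⟨p, hp⟩ := h (fun Γ => (f Γ - a) / d) fun Γ =>
    ⟨div_nonneg (by linarith [(ha Γ).1]) hd.le, (div_le_one hd).2 (by linarith [(ha Γ).2])⟩
  refine ⟨p, oscLE_of_affine hB hN (c := a) hd.le (fun Γ => ?_) hp⟩
  field_simp
  ring

/-- A bound for 2-colourings yields one for `[0,1]`-valued functions. -/
theorem exists_oscLE_three_quarters
    (hB : (⟨B, inferInstance⟩ : Bundled.{w} L.Structure) ∈ K.carrier)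
    (hN : L.age N ⊆ K.carrier)
    (h : ∀ f : K.ClosedEmb A N → ℝ, (∀ Γ, f Γ = 0 ∨ f Γ = 1) →
      ∃ p : StdSimplex ℝ (K.ClosedEmb B N), OscLE p f (1 / 2))
    (f : K.ClosedEmb A N → ℝ) (hf : ∀ Γ, f Γ ∈ Set.Icc 0 1) :
    ∃ p : StdSimplex ℝ (K.ClosedEmb B N), OscLE p f (3 / 4) := by
  classical
  -- Round f at 1/2. Since g/2 ≤ f ≤ 1/2 + g/2, an oscillation 1/2 for the average of g gives 1/2 +
  -- 1/4 = 3/4 for that of f.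
  let g : K.ClosedEmb A N → ℝ := fun Γ => if 1 / 2 ≤ f Γ then 1 else 0
  have hg : ∀ Γ, 1 / 2 * g Γ ≤ f Γ ∧ f Γ ≤ 1 / 2 + 1 / 2 * g Γ := by
    intro Γ
    have := hf Γ
    dsimp only [g]
    split_ifs with h1
    · constructor <;> linarith [this.1, this.2]
    · constructor <;> linarith [this.1, this.2]
  obtain ⟨p, hp⟩ := h g fun Γ => by
    dsimp only [g]
    split_ifs <;> simp
  refine ⟨p, ?_⟩
  rw [oscLE_iff hB hN] at hp ⊢
  have hlow : ∀ Γ, 1 / 2 * average hB hN p g Γ ≤ average hB hN p f Γ := fun Γ => by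
    simp only [average]
    rw [← StdSimplex.evalAt_const_mul]
    exact p.evalAt_mono fun Λ => (hg _).1
  have hup : ∀ Γ, average hB hN p f Γ ≤ 1 / 2 + 1 / 2 * average hB hN p g Γ := fun Γ => by
    simp only [average]
    rw [← StdSimplex.evalAt_const_mul, ← p.evalAt_const (1 / 2), ← StdSimplex.evalAt_add,
      p.evalAt_const]
    exact p.evalAt_mono fun Λ => (hg _).2
  intro Γ₁ Γ₂
  have h1 := abs_le.1 (hp Γ₁ Γ₂)
  rw [abs_le]
  constructor <;> linarith [hlow Γ₁, hlow Γ₂, hup Γ₁, hup Γ₂]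

/-- The identity as a closed embedding. -/
noncomputable def ClosedEmb.refl (hB : (⟨B, inferInstance⟩ : Bundled.{w} L.Structure) ∈ K.carrier) :
    K.ClosedEmb B B :=
  ⟨Embedding.refl L B, by
    rw [closedIn_iff hB]
    have h1 : (Embedding.refl L B).toHom.range = ⊤ :=
      top_le_iff.1 fun x _ => Hom.mem_range.2 ⟨x, rfl⟩
    exact h1 ▸ K.closed_refl _ hB⟩

end Average

/-! ### The finitary conditions -/

section Finitary

variable [L.IsRelational]

/-- Each round gains a factor 3/4: averaging from C₂ down to C₁ leaves a function of oscillation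
3/4, to which the inductive bound for C₁ applies after rescaling. -/
theorem ConvexRamsey.exists_pow (h : K.ConvexRamsey) (k : ℕ) :
    ∀ A ∈ K.carrier, ∀ B ∈ K.carrier, Nonempty (K.ClosedEmb A B) →
      ∃ C ∈ K.carrier, Nonempty (K.ClosedEmb B C) ∧
        ∀ f : K.ClosedEmb A C → ℝ, (∀ Γ, f Γ ∈ Set.Icc 0 1) →
          ∃ p : StdSimplex ℝ (K.ClosedEmb B C), OscLE p f ((3 / 4) ^ k) := by
  intro A hA B hB hAB
  induction k with
  | zero =>
    refine ⟨B, hB, ⟨ClosedEmb.refl hB⟩, fun f hf => ⟨.single (ClosedEmb.refl hB), ?_⟩⟩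
    rw [pow_zero]
    exact oscLE_one hB (age_subset_of_mem hB) _ hf
  | succ k ih =>
    obtain ⟨C₁, hC₁, ⟨i₁⟩, h₁⟩ := ih
    obtain ⟨j⟩ := hAB
    obtain ⟨C₂, hC₂, ⟨i₂⟩, h₂⟩ :=
      h A hA C₁ hC₁ ⟨i₁.comp hB (age_subset_of_mem hC₁) j⟩
    refine ⟨C₂, hC₂, ⟨i₂.comp hC₁ (age_subset_of_mem hC₂) i₁⟩, fun f hf => ?_⟩
    obtain ⟨p₂, hp₂⟩ := exists_oscLE_three_quarters hC₁ (age_subset_of_mem hC₂) h₂ f hf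
    rw [oscLE_iff hC₁ (age_subset_of_mem hC₂)] at hp₂
    obtain ⟨p₁, hp₁⟩ := exists_oscLE_mul hB (age_subset_of_mem hC₁) h₁ _ (by norm_num) hp₂
    refine ⟨compose hC₁ (age_subset_of_mem hC₂) p₂ p₁, ?_⟩
    rw [pow_succ']
    exact OscLE.compose_right hB hC₁ (age_subset_of_mem hC₂) hp₁

theorem ConvexRamsey.convexRamseyReal (h : K.ConvexRamsey) : K.ConvexRamseyReal := by
  intro A hA B hB hAB ε hε
  obtain ⟨k, hk⟩ := exists_pow_lt_of_lt_one hε (show (3 / 4 : ℝ) < 1 by norm_num)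
  obtain ⟨C, hC, hBC, hp⟩ := h.exists_pow k A hA B hB hAB
  refine ⟨C, hC, hBC, fun f hf => ?_⟩
  obtain ⟨p, hp⟩ := hp f hf
  exact ⟨p, hp.mono hk.le⟩

theorem ConvexRamseyReal.convexRamseyMulti (h : K.ConvexRamseyReal) : K.ConvexRamseyMulti := by
  intro A hA B hB hAB ε hε n
  induction n with
  | zero =>
    exact ⟨B, hB, ⟨ClosedEmb.refl hB⟩, fun f hf =>
      ⟨.single (ClosedEmb.refl hB), fun i => i.elim0⟩⟩
  | succ n ih =>
    obtain ⟨C₁, hC₁, ⟨i₁⟩, h₁⟩ := ih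
    obtain ⟨j⟩ := hAB
    obtain ⟨C₂, hC₂, ⟨i₂⟩, h₂⟩ :=
      h A hA C₁ hC₁ ⟨i₁.comp hB (age_subset_of_mem hC₁) j⟩ ε hε
    refine ⟨C₂, hC₂, ⟨i₂.comp hC₁ (age_subset_of_mem hC₂) i₁⟩, fun f hf => ?_⟩
    obtain ⟨p₂, hp₂⟩ := h₂ (f (Fin.last n)) (hf _)
    obtain ⟨p₁, hp₁⟩ := h₁ (fun i => average hC₁ (age_subset_of_mem hC₂) p₂ (f i.castSucc))
      fun i => average_mem_Icc hC₁ (age_subset_of_mem hC₂) p₂ (hf _)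
    refine ⟨compose hC₁ (age_subset_of_mem hC₂) p₂ p₁, fun i => ?_⟩
    induction i using Fin.lastCases with
    | last => exact hp₂.compose_left hB hC₁ (age_subset_of_mem hC₂) p₁
    | cast i => exact (hp₁ i).compose_right hB hC₁ (age_subset_of_mem hC₂)

variable {M : Type w} [L.Structure M]

/-- Compactness: bad colourings of the members of the chain have a bad ultralimit. -/
theorem IsGeneric.convexRamsey (hM : K.IsGeneric M) (h : K.AutConvexRamsey M) :
    K.ConvexRamsey := by
  classical
  intro A hA B hB hAB
  by_contra hcon
  push Not at hcon
  have hN := hM.age_subset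
  obtain ⟨T, hfin, hmono, hcl, hcov⟩ := hM.exists_chain
  have hT := fun k => mem_of_age hN (T k)
  have := K.finite A hA
  have := K.finite B hB
  have : Finite (K.ClosedEmb A B) := finite_closedEmb
  obtain ⟨e⟩ := hM.nonempty_closedEmb hB
  have hev : ∀ Λ : K.ClosedEmb B M, ∀ᶠ k in Filter.atTop, ∀ b, Λ.1 b ∈ T k := by
    intro Λ
    obtain ⟨k, hk⟩ := hcov _ (Set.finite_range Λ.1)
    filter_upwards [Filter.eventually_ge_atTop k] with l hl b
    exact hmono hl (hk ⟨b, rfl⟩)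
  let inc : ∀ k, K.ClosedEmb (T k) M := fun k => (hcl k).subtype
  -- A bad colouring of `T k`, extended by 0 to M. For early k, where the image of `e` is not yet
  -- inside `T k`, any colouring will do.
  have hbad : ∀ k, ∃ F : K.ClosedEmb A M → ℝ, (∀ Γ, F Γ = 0 ∨ F Γ = 1) ∧
      ((∀ b, e.1 b ∈ T k) → ∀ p : StdSimplex ℝ (K.ClosedEmb B (T k)),
        ¬ OscLE p (fun Γ : K.ClosedEmb A (T k) => F ((inc k).comp (hT k) hN Γ)) (1 / 2)) := by
    intro k
    by_cases hk : ∀ b, e.1 b ∈ T k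
    · obtain ⟨f, hf, hbad⟩ := hcon _ (hT k) ⟨e.codRestrict hN (T k) hk⟩
      refine ⟨fun Γ => if hΓ : ∀ a, Γ.1 a ∈ T k then f (Γ.codRestrict hN (T k) hΓ) else 0,
        fun Γ => ?_, fun _ p => ?_⟩
      · dsimp only
        split_ifs
        · exact hf _
        · exact Or.inl rfl
      · have key : (fun Γ : K.ClosedEmb A (T k) =>
            if hΓ : ∀ a, ((inc k).comp (hT k) hN Γ).1 a ∈ T k then
              f (((inc k).comp (hT k) hN Γ).codRestrict hN (T k) hΓ) else 0) = f :=
          funext fun Γ => dif_pos fun a => (Γ.1 a).2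
        rw [key]
        exact hbad p
    · exact ⟨fun _ => 0, fun _ => Or.inl rfl, fun hk' => absurd hk' hk⟩
  choose F hF hbad using hbad
  let U := Filter.hyperfilter ℕ
  have hU : (U : Filter ℕ) ≤ Filter.atTop := Nat.hyperfilter_le_atTop
  let G : K.ClosedEmb A M → ℝ := fun Γ => if ∀ᶠ k in U, F k Γ = 1 then 1 else 0
  have hG : ∀ Γ, ∀ᶠ k in U, F k Γ = G Γ := by
    intro Γ
    by_cases hΓ : ∀ᶠ k in U, F k Γ = 1
    · simpa only [G, if_pos hΓ] using hΓ
    · have h1 := Ultrafilter.eventually_not.2 hΓ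
      simp only [G, if_neg hΓ]
      filter_upwards [h1] with k hk
      exact (hF k Γ).resolve_right hk
  obtain ⟨p, hp⟩ := h A hA B hB hAB G fun Γ => by
    dsimp only [G]
    split_ifs <;> simp
  -- The support of p and the set of closed embeddings A → B are finite, so a single k serves for
  -- all relevant values.
  have hagree : ∀ᶠ k in (U : Filter ℕ), ∀ Λ ∈ p.weights.support, ∀ Γ : K.ClosedEmb A B,
      F k (Λ.comp hB hN Γ) = G (Λ.comp hB hN Γ) :=
    (Finset.eventually_all _).2 fun Λ _ => Filter.eventually_all.2 fun Γ => hG _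
  have hrange : ∀ᶠ k in (U : Filter ℕ), ∀ Λ ∈ p.weights.support, ∀ b, Λ.1 b ∈ T k :=
    (Finset.eventually_all _).2 fun Λ _ => hU (hev Λ)
  obtain ⟨k, hk1, hk2, hk3⟩ := (hagree.and (hrange.and (hU (hev e)))).exists
  -- The default value is never used on the support of p.
  let r : K.ClosedEmb B M → K.ClosedEmb B (T k) := fun Λ =>
    if hΛ : ∀ b, Λ.1 b ∈ T k then Λ.codRestrict hN (T k) hΛ else e.codRestrict hN (T k) hk3
  refine hbad k hk3 (p.map r) ?_
  rw [oscLE_iff hB hN] at hp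
  rw [oscLE_iff hB (age_subset_of_mem (hT k))]
  have key : ∀ Γ, average hB (age_subset_of_mem (hT k)) (p.map r)
      (fun Γ : K.ClosedEmb A (T k) => F k ((inc k).comp (hT k) hN Γ)) Γ =
      average hB hN p G Γ := by
    intro Γ
    rw [average, StdSimplex.evalAt_map]
    refine p.evalAt_congr fun Λ hΛ => ?_
    rw [← hk1 Λ hΛ Γ]
    congr 1
    have hr : r Λ = Λ.codRestrict hN (T k) (hk2 Λ hΛ) := dif_pos (hk2 Λ hΛ)
    rw [hr]
    rfl
  intro Γ₁ Γ₂
  rw [key, key]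
  exact hp Γ₁ Γ₂

end Finitary

end FirstOrder.Language.SmoothClass

/-! ### Amenability and finitely supported means -/

open scoped Topology

theorem Convexity.StdSimplex.exists_probabilityMeasure {X : Type*} [MeasurableSpace X]
    [MeasurableSingletonClass X] (q : StdSimplex ℝ X) :
    ∃ μ : ProbabilityMeasure X, ∀ φ : X → ℝ, ∫ x, φ x ∂(μ : Measure X) = q.evalAt φ := by
  let ν : Measure X := ∑ x ∈ q.weights.support, ENNReal.ofReal (q.weights x) • Measure.dirac x
  have hν : IsProbabilityMeasure ν := by
    constructor
    simp only [ν, Measure.finsetSum_apply, Measure.smul_apply, measure_univ, smul_eq_mul, mul_one]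
    rw [← ENNReal.ofReal_sum_of_nonneg fun x _ => q.weights_nonneg x]
    exact (congrArg ENNReal.ofReal q.total).trans ENNReal.ofReal_one
  refine ⟨⟨ν, hν⟩, fun φ => ?_⟩
  change ∫ x, φ x ∂ν = _
  have hint : ∀ x ∈ q.weights.support,
      Integrable φ (ENNReal.ofReal (q.weights x) • Measure.dirac x) := fun x _ =>
    (integrable_dirac (by simp)).smul_measure ENNReal.ofReal_ne_top
  simp only [ν]
  rw [integral_finsetSum_measure hint]
  refine Finset.sum_congr rfl fun x _ => ?_
  rw [integral_smul_measure, integral_dirac, ENNReal.toReal_ofReal (q.weights_nonneg x), smul_eq_mul]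

theorem Convexity.StdSimplex.evalAt_convexCombPair {X : Type*} (p q : StdSimplex ℝ X) {a b : ℝ}
    (ha : 0 ≤ a) (hb : 0 ≤ b) (hab : a + b = 1) (f : X → ℝ) :
    (convexCombPair a b ha hb hab p q).evalAt f = a * p.evalAt f + b * q.evalAt f := by
  classical
  rw [evalAt, weights_convexCombPair, Finsupp.sum_add_index' (by simp) (by intros; ring),
    Finsupp.sum_smul_index' (by simp), Finsupp.sum_smul_index' (by simp)]
  simp only [evalAt, Finsupp.mul_sum, smul_eq_mul, mul_assoc]

/-- The orbit maps of a continuous action on a compact space are equicontinuous when composed with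
a continuous function. -/
theorem exists_nhds_one_forall_abs_sub_le {G X : Type*} [Group G]
    [TopologicalSpace G] [TopologicalSpace X] [CompactSpace X]
    [MulAction G X] [ContinuousSMul G X] (φ : C(X, ℝ)) {δ : ℝ} (hδ : 0 < δ) :
    ∃ U ∈ 𝓝 (1 : G), ∀ g ∈ U, ∀ x, |φ (g • x) - φ x| ≤ δ := by
  let Φ : C(G, C(X, ℝ)) := ContinuousMap.curry ⟨fun x : G × X => φ (x.1 • x.2), by fun_prop⟩
  refine ⟨Φ ⁻¹' Metric.closedBall (Φ 1) δ,
    Φ.continuous.continuousAt.preimage_mem_nhds (Metric.closedBall_mem_nhds _ hδ), fun g hg x => ?_⟩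
  have h1 := ((Φ g).dist_apply_le_dist (g := Φ 1) x).trans hg
  rw [Real.dist_eq] at h1
  simpa [Φ] using h1

section Amenable

variable {G : Type w} [Group G] [TopologicalSpace G] [IsTopologicalGroup G] [T2Space G]

/-! ### From amenability to means, via orbit closures -/

section OrbitClosure

attribute [local instance] arrowAction

omit [T2Space G] in
-- The coordinate of g • y at s is y(g⁻¹ • s), and g⁻¹ • s is locally constant in g.
theorem continuousSMul_arrow {S Z : Type*} [MulAction G S] [TopologicalSpace Z]
    (hS : ∀ s t : S, IsOpen {g : G | g • s = t}) : ContinuousSMul G (S → Z) := by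
  refine ⟨continuous_pi fun s => continuous_iff_continuousAt.2 fun x₀ => ?_⟩
  have hev : ∀ᶠ x : G × (S → Z) in 𝓝 x₀, x.1⁻¹ • s = x₀.1⁻¹ • s :=
    ((hS s (x₀.1⁻¹ • s)).preimage (continuous_fst.inv)).mem_nhds rfl
  have hc : ContinuousAt (fun x : G × (S → Z) => x.2 (x₀.1⁻¹ • s)) x₀ := by fun_prop
  refine hc.congr ?_
  filter_upwards [hev] with x hx
  exact congrArg x.2 hx.symm

/-- Amenability yields finitely supported means that are almost constant on orbits. -/
theorem IsAmenableGroup.exists_mean (hG : IsAmenableGroup G) {S : Type w} [MulAction G S]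
    (hS : ∀ s t : S, IsOpen {g : G | g • s = t}) (f : S → ℝ) (hf : ∀ s, f s ∈ Set.Icc 0 1)
    {ι : Type*} [Finite ι] (e : ι → S) {ε : ℝ} (hε : 0 < ε) :
    ∃ p : StdSimplex ℝ G, ∀ i j, (∃ g : G, g • e i = e j) →
      |(p.evalAt fun g => f (g⁻¹ • e i)) - p.evalAt fun g => f (g⁻¹ • e j)| ≤ ε := by
  have := Fintype.ofFinite ι
  have hcs : ContinuousSMul G (S → ℝ) := continuousSMul_arrow hS
  have hsmul : ∀ (g : G) (y : S → ℝ) s, (g • y) s = y (g⁻¹ • s) := fun _ _ _ => rfl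
  -- The orbit closure of f, a closed invariant subset of the compact cube [0,1]^S.
  let Y : SubMulAction G (S → ℝ) :=
    { carrier := closure (Set.range fun g : G => g • f)
      smul_mem' := fun g y hy => by
        refine map_mem_closure (continuous_const_smul g) hy ?_
        rintro _ ⟨h, rfl⟩
        exact ⟨g * h, mul_smul g h f⟩ }
  have hcpt : IsCompact (Y : Set (S → ℝ)) := by
    refine (isCompact_univ_pi fun _ : S => isCompact_Icc (a := (0 : ℝ)) (b := 1)).of_isClosed_subset
      isClosed_closure (closure_minimal ?_ (isClosed_set_pi fun _ _ => isClosed_Icc))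
    rintro _ ⟨g, rfl⟩ s -
    exact hf _
  have : CompactSpace Y := isCompact_iff_compactSpace.1 hcpt
  have : Nonempty Y := ⟨⟨f, subset_closure ⟨1, one_smul G f⟩⟩⟩
  let : MeasurableSpace Y := borel Y
  have : BorelSpace Y := ⟨rfl⟩
  obtain ⟨μ, hμ, hinv⟩ := hG Y
  -- `D` is convex and its closure contains the restriction to `e` of every point of `Y`, hence also
  -- the barycentre under μ. A point of `D` within ε/2 of it gives p.
  let D : Set (ι → ℝ) := Set.range fun (p : StdSimplex ℝ G) i => p.evalAt fun g => f (g⁻¹ • e i)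
  have hD : Convex ℝ D := by
    rintro _ ⟨p, rfl⟩ _ ⟨q, rfl⟩ a b ha hb hab
    refine ⟨convexCombPair a b ha hb hab p q, ?_⟩
    funext i
    exact p.evalAt_convexCombPair q ha hb hab _
  have hV : Continuous fun (y : S → ℝ) i => y (e i) := by fun_prop
  have hmem : ∀ y : Y, (fun i => y.1 (e i)) ∈ closure D := by
    refine fun y => map_mem_closure hV y.2 ?_
    rintro _ ⟨g, rfl⟩
    exact ⟨.single g, funext fun i => StdSimplex.evalAt_single _ _⟩
  have hVY : Continuous fun (y : Y) i => y.1 (e i) := hV.comp continuous_subtype_val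
  have hint : Integrable (fun (y : Y) i => y.1 (e i)) μ :=
    hVY.integrable_of_hasCompactSupport (HasCompactSupport.of_compactSpace _)
  have hI := hD.closure.integral_mem isClosed_closure (Filter.Eventually.of_forall hmem) hint
  obtain ⟨_, ⟨p, rfl⟩, hp⟩ := Metric.mem_closure_iff.1 hI (ε / 2) (half_pos hε)
  refine ⟨p, ?_⟩
  rintro i j ⟨g, hg⟩
  have hpi : ∀ i, |(∫ y : Y, y.1 (e i) ∂μ) - p.evalAt fun g => f (g⁻¹ • e i)| < ε / 2 := by
    intro i
    have h1 := (dist_le_pi_dist _ _ i).trans_lt hp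
    rw [Real.dist_eq, eval_integral fun i => hint.eval i] at h1
    exact h1
  have hij : ∫ y : Y, y.1 (e i) ∂μ = ∫ y : Y, y.1 (e j) ∂μ := by
    conv_rhs => rw [← hinv g]
    have hcg : Continuous fun y : Y => g • y := continuous_const_smul _
    have hcj : Continuous fun y : Y => y.1 (e j) :=
      (continuous_apply (e j)).comp continuous_subtype_val
    rw [integral_map hcg.measurable.aemeasurable hcj.measurable.aestronglyMeasurable]
    refine integral_congr_ae (Filter.Eventually.of_forall fun y => ?_)
    change y.1 (e i) = y.1 (g⁻¹ • e j)
    rw [← hg, inv_smul_smul]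
  have h1 := abs_lt.1 (hpi i)
  have h2 := abs_lt.1 (hpi j)
  rw [abs_le]
  constructor <;> linarith [h1.1, h1.2, h2.1, h2.2]

end OrbitClosure

/-- A sufficient condition for amenability in terms of finitely supported means on the group that
are almost invariant for finitely many functions. -/
theorem isAmenableGroup_of_exists_mean
    (h : ∀ U ∈ 𝓝 (1 : G), ∀ (S : Finset G) (n : ℕ) (ψ : Fin n → G → ℝ) (δ : ℝ), 0 < δ →
      (∀ i g, ψ i g ∈ Set.Icc 0 1) → (∀ i g, ∀ k ∈ U, |ψ i (g * k) - ψ i g| ≤ δ) →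
      ∃ p : StdSimplex ℝ G, ∀ i, ∀ s ∈ S, |p.evalAt (ψ i) - p.evalAt fun g => ψ i (g * s)| ≤ 3 * δ) :
    IsAmenableGroup G := by
  intro X _ _ _ hX _ _ _ _
  obtain ⟨x₀⟩ := hX
  let Φ : Type w := {φ : C(X, ℝ) // ∀ x, φ x ∈ Set.Icc 0 1}
  let tr : C(X, ℝ) → G → C(X, ℝ) := fun φ g => φ.comp ⟨fun x => g • x, continuous_const_smul g⟩
  -- Weakly closed sets of measures, invariant up to 1/(k+1) for one test function and one group
  -- element; by compactness only finite intersections need a point.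
  let Z : Φ × G × ℕ → Set (ProbabilityMeasure X) := fun t =>
    {μ | |∫ x, t.1.1 x ∂(μ : Measure X) - ∫ x, tr t.1.1 t.2.1 x ∂(μ : Measure X)| ≤ 1 / (t.2.2 + 1)}
  have hZ : ∀ t, IsClosed (Z t) := fun t =>
    isClosed_le ((ProbabilityMeasure.continuous_integral_continuousMap t.1.1).sub
      (ProbabilityMeasure.continuous_integral_continuousMap (tr t.1.1 t.2.1))).abs continuous_const
  have hfin : ∀ t : Finset (Φ × G × ℕ), (⋂ i ∈ t, Z i).Nonempty := by
    classical
    intro t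
    obtain ⟨m, hm⟩ : ∃ m : ℕ, ∀ i ∈ t, i.2.2 ≤ m :=
      ⟨t.sup fun i => i.2.2, fun i hi => Finset.le_sup (f := fun i : Φ × G × ℕ => i.2.2) hi⟩
    have hδ : (0 : ℝ) < 1 / (3 * (m + 1)) := by positivity
    choose U hU hUφ using fun φ : C(X, ℝ) => exists_nhds_one_forall_abs_sub_le (G := G) φ hδ
    let φ : Fin t.card → C(X, ℝ) := fun i => (t.equivFin.symm i).1.1.1
    -- Apply the hypothesis to ψᵢ(g) = φᵢ(g⁻¹ • x₀). Right translation of g by k acts on the orbit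
    -- point as k⁻¹, hence the inverses of the neighbourhoods and of the group elements. The choice
    -- of δ makes 3δ = 1/(m+1).
    obtain ⟨p, hp⟩ := h (⋂ i, (U (φ i))⁻¹) (Filter.iInter_mem.2 fun i => inv_mem_nhds_one G (hU _))
      (t.image fun i => i.2.1⁻¹) t.card (fun i g => φ i (g⁻¹ • x₀)) _ hδ
      (fun i g => (t.equivFin.symm i).1.1.2 _) fun i g k hk => by
        rw [mul_inv_rev, mul_smul]
        exact hUφ _ _ (Set.mem_iInter.1 hk i) _
    obtain ⟨μ, hμ⟩ := (p.map fun g => g⁻¹ • x₀).exists_probabilityMeasure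
    refine ⟨μ, Set.mem_iInter₂.2 fun i hi => ?_⟩
    have h1 := hp (t.equivFin ⟨i, hi⟩) i.2.1⁻¹ (Finset.mem_image_of_mem _ hi)
    simp only [φ, Equiv.symm_apply_apply, mul_inv_rev, inv_inv, mul_smul] at h1
    change |∫ x, i.1.1 x ∂(μ : Measure X) - ∫ x, tr i.1.1 i.2.1 x ∂(μ : Measure X)| ≤ _
    rw [hμ, hμ, StdSimplex.evalAt_map, StdSimplex.evalAt_map]
    refine h1.trans ?_
    have h2 : (i.2.2 : ℝ) + 1 ≤ m + 1 := by exact_mod_cast Nat.succ_le_succ (hm i hi)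
    rw [show 3 * (1 / (3 * ((m : ℝ) + 1))) = 1 / (m + 1) by field_simp]
    exact one_div_le_one_div_of_le (by positivity) h2
  obtain ⟨μ, hμ⟩ := CompactSpace.iInter_nonempty hZ hfin
  have hμZ : ∀ t, μ ∈ Z t := Set.mem_iInter.1 hμ
  have hΦ : ∀ (φ : Φ) g, ∫ x, φ.1 x ∂(μ : Measure X) = ∫ x, tr φ.1 g x ∂(μ : Measure X) := by
    intro φ g
    refine sub_eq_zero.1 (abs_eq_zero.1 (le_antisymm ?_ (abs_nonneg _)))
    exact ge_of_tendsto tendsto_one_div_add_atTop_nhds_zero_nat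
      (Filter.Eventually.of_forall fun k => hμZ (φ, g, k))
  have hint : ∀ φ : C(X, ℝ), Integrable φ (μ : Measure X) := fun φ =>
    φ.continuous.integrable_of_hasCompactSupport (HasCompactSupport.of_compactSpace _)
  have hinv : ∀ (φ : C(X, ℝ)) g, ∫ x, φ x ∂(μ : Measure X) = ∫ x, tr φ g x ∂(μ : Measure X) := by
    intro φ g
    have hc : 0 < ‖φ‖ + 1 := by positivity
    -- An affine change moves φ into [0,1] and commutes with integration.
    let φ' : Φ := ⟨(1 / (2 * (‖φ‖ + 1))) • φ + ContinuousMap.const X (1 / 2), fun x => by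
      have h1 : |1 / (2 * (‖φ‖ + 1)) * φ x| ≤ 1 / 2 := by
        rw [abs_mul, abs_of_pos (by positivity), one_div, mul_comm, ← div_eq_mul_inv,
          div_le_div_iff₀ (by positivity) (by positivity)]
        have := φ.norm_coe_le_norm x
        rw [Real.norm_eq_abs] at this
        linarith
      have h2 := abs_le.1 h1
      constructor
      · simp only [ContinuousMap.add_apply, ContinuousMap.smul_apply, ContinuousMap.const_apply,
          smul_eq_mul]
        linarith [h2.1]
      · simp only [ContinuousMap.add_apply, ContinuousMap.smul_apply, ContinuousMap.const_apply,
          smul_eq_mul]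
        linarith [h2.2]⟩
    have key : ∀ χ : C(X, ℝ), ∫ x, (1 / (2 * (‖φ‖ + 1)) * χ x + 1 / 2) ∂(μ : Measure X) =
        1 / (2 * (‖φ‖ + 1)) * ∫ x, χ x ∂(μ : Measure X) + 1 / 2 := by
      intro χ
      rw [integral_add ((hint χ).const_mul _) (integrable_const _), integral_const_mul]
      simp
    have h3 : ∫ x, (1 / (2 * (‖φ‖ + 1)) * φ x + 1 / 2) ∂(μ : Measure X) =
        ∫ x, (1 / (2 * (‖φ‖ + 1)) * tr φ g x + 1 / 2) ∂(μ : Measure X) := hΦ φ' g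
    rw [key, key] at h3
    exact mul_left_cancel₀ (by positivity) (add_right_cancel h3)
  -- X need not be metrizable, so integrals of continuous functions determine a measure only among
  -- regular ones; pass to the regular one.
  obtain ⟨ν, hνr, hνf, hν⟩ := Measure.exists_regular_eq_of_compactSpace (μ : Measure X)
  have hνφ : ∀ φ : C(X, ℝ), ∫ x, φ x ∂(μ : Measure X) = ∫ x, φ x ∂ν := fun φ =>
    hν (BoundedContinuousFunction.mkOfCompact φ)
  refine ⟨ν, ⟨?_⟩, fun g => ?_⟩
  · have h1 := hνφ (ContinuousMap.const X 1)
    simp only [ContinuousMap.const_apply, integral_const, smul_eq_mul, mul_one,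
      probReal_univ] at h1
    rw [measureReal_def] at h1
    exact (ENNReal.toReal_eq_one_iff _).1 h1.symm
  · have hmap : ν.map (fun x => g • x) = ν.map (Homeomorph.smul g) := rfl
    have : (ν.map (Homeomorph.smul g)).Regular := Measure.Regular.map _
    rw [hmap]
    refine Measure.ext_of_integral_eq_on_compactlySupported fun f => ?_
    let φ : C(X, ℝ) := f.toContinuousMap
    rw [integral_map (Homeomorph.smul g).continuous.measurable.aemeasurable
      (map_continuous f).measurable.aestronglyMeasurable]
    exact ((hνφ (tr φ g)).symm.trans (hinv φ g).symm).trans (hνφ φ)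

end Amenable

/-! ### Means on the automorphism group of the generic structure -/

namespace FirstOrder.Language

variable {L : Language.{u, v}} {M : Type w} [L.Structure M]

/-- Pointwise stabilizers of finite sets form a neighbourhood basis of the identity. -/
theorem exists_finite_of_mem_nhds_one {U : Set (M ≃[L] M)} (hU : U ∈ 𝓝 (1 : M ≃[L] M)) :
    ∃ F : Set M, F.Finite ∧ ∀ g : M ≃[L] M, (∀ a ∈ F, g a = a) → g ∈ U := by
  let : TopologicalSpace M := ⊥
  obtain ⟨V, hV, hVU⟩ := (mem_nhds_induced _ _ _).1 hU
  obtain ⟨W, hWV, hW, h1W⟩ := mem_nhds_iff.1 hV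
  obtain ⟨I, u, hu, hIW⟩ := isOpen_pi_iff.1 hW _ h1W
  refine ⟨I, I.finite_toSet, fun g hg => hVU (hWV (hIW fun a ha => ?_))⟩
  change g a ∈ u a
  rw [hg a ha]
  exact (hu a ha).2

namespace SmoothClass

variable {K : SmoothClass.{u, v, w} L} [L.IsRelational]

section Action

variable {A : Type w} [L.Structure A]

/-- Automorphisms act on closed embeddings by composition. -/
noncomputable abbrev autAction (hN : L.age M ⊆ K.carrier) :
    MulAction (M ≃[L] M) (K.ClosedEmb A M) where
  smul g Γ := ⟨g.toEmbedding.comp Γ.1, Γ.2.map_equiv hN g fun x => by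
    constructor
    · intro hx
      obtain ⟨a, rfl⟩ := Hom.mem_range.1 hx
      exact Hom.mem_range.2 ⟨a, rfl⟩
    · intro hx
      obtain ⟨a, ha⟩ := Hom.mem_range.1 hx
      exact Hom.mem_range.2 ⟨a, g.injective ha⟩⟩
  one_smul _ := rfl
  mul_smul _ _ _ := rfl

theorem isOpen_autAction_smul_eq [Finite A] (hN : L.age M ⊆ K.carrier) (Γ Γ' : K.ClosedEmb A M) :
    letI := autAction (A := A) hN
    IsOpen {g : M ≃[L] M | g • Γ = Γ'} := by
  let := autAction (A := A) hN
  have h1 : {g : M ≃[L] M | g • Γ = Γ'} = ⋂ a, {g : M ≃[L] M | g (Γ.1 a) = Γ'.1 a} := by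
    ext g
    simp only [Set.mem_iInter]
    exact ⟨fun h a => h ▸ rfl, fun h => ClosedEmb.ext h⟩
  rw [h1]
  exact isOpen_iInter_of_finite fun a => isOpen_aut_apply_eq _ _

end Action

/-- Fix Λ : B → M. By homogeneity the embeddings Λ ∘ Γ lie in one orbit, so a mean on the group
makes their averaged colours nearly equal. -/
theorem IsGeneric.autConvexRamsey (hM : K.IsGeneric M) (hG : IsAmenableGroup (M ≃[L] M)) :
    K.AutConvexRamsey M := by
  intro A hA B hB _ f hf
  have hN := hM.age_subset
  have := K.finite A hA
  have := K.finite B hB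
  have : Finite (K.ClosedEmb A B) := finite_closedEmb
  let := autAction (A := A) hN
  obtain ⟨Λ⟩ := hM.nonempty_closedEmb hB
  obtain ⟨p, hp⟩ := hG.exists_mean (isOpen_autAction_smul_eq (A := A) hN) f
    (fun Γ => by rcases hf Γ with h | h <;> simp [h]) (fun Γ : K.ClosedEmb A B => Λ.comp hB hN Γ)
    (show (0 : ℝ) < 1 / 2 by norm_num)
  let actB := autAction (K := K) (A := B) hN
  -- The mean evaluates f at g⁻¹ ∘ Λ ∘ Γ, so p is pushed forward to the law of g⁻¹ ∘ Λ.
  refine ⟨p.map fun g => actB.smul g⁻¹ Λ, ?_⟩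
  rw [oscLE_iff hB hN]
  intro Γ₁ Γ₂
  simp only [average, StdSimplex.evalAt_map]
  refine hp Γ₁ Γ₂ ?_
  obtain ⟨g, hg⟩ := hM.exists_aut (Λ.comp hB hN Γ₁) (Λ.comp hB hN Γ₂)
  exact ⟨g, ClosedEmb.ext hg⟩

/-- Translation by s becomes the change from the inclusion A → B to the restriction of s to A, once
B contains A and all sA. The Ramsey condition makes the averages at these two embeddings agree. -/
theorem IsGeneric.isAmenableGroup (hM : K.IsGeneric M) (h : K.ConvexRamseyMulti) :
    IsAmenableGroup (M ≃[L] M) := by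
  refine isAmenableGroup_of_exists_mean fun U hU S n ψ δ hδ hψ hψU => ?_
  have hN := hM.age_subset
  obtain ⟨F, hF, hFU⟩ := exists_finite_of_mem_nhds_one hU
  obtain ⟨A, hA, hFA⟩ := hM.exists_closedIn hF
  have := hA.1
  obtain ⟨B, hB, hAB⟩ := hM.exists_closedIn (F := A ∪ ⋃ s ∈ S, s '' A)
    ((Set.toFinite _).union (S.finite_toSet.biUnion fun s _ => (Set.toFinite (A : Set M)).image s))
  have := hB.1
  have hBm := mem_of_age hN B
  let act := autAction (K := K) (A := A) hN
  let Γ₀ : K.ClosedEmb A B := hA.subtype.codRestrict hN B fun a => hAB (Or.inl a.2)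
  have hΓ : ∀ s ∈ S, ∃ Γ : K.ClosedEmb A B, ∀ a, (Γ.1 a : M) = s a := fun s hs =>
    ⟨(act.smul s hA.subtype).codRestrict hN B fun a =>
      hAB (Or.inr (Set.mem_biUnion hs ⟨a, a.2, rfl⟩)), fun a => rfl⟩
  -- Homogeneity extends closed embeddings of A and B to automorphisms; ψ at the chosen extension
  -- colours an embedding of A.
  choose hA' hhA' using fun Γ : K.ClosedEmb A M => hM.exists_aut hA.subtype Γ
  choose hB' hhB' using fun Γ : K.ClosedEmb B M => hM.exists_aut hB.subtype Γ
  obtain ⟨C, hC, -, hp⟩ := h _ (mem_of_age hN A) _ hBm ⟨Γ₀⟩ δ hδ n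
  obtain ⟨e⟩ := hM.nonempty_closedEmb hC
  obtain ⟨p, hp⟩ := hp (fun i Γ => ψ i (hA' (e.comp hC hN Γ))) fun i Γ => hψ _ _
  have hCa := age_subset_of_mem hC
  refine ⟨p.map fun Λ => hB' (e.comp hC hN Λ), fun i s hs => ?_⟩
  obtain ⟨Γ, hΓs⟩ := hΓ s hs
  have h0 := (oscLE_iff hBm hCa).1 (hp i) Γ₀ Γ
  -- Automorphisms agreeing on A differ on the right by an element fixing A pointwise, hence by an
  -- element of U.
  have hclose : ∀ g₁ g₂ : M ≃[L] M, (∀ a : A, g₁ a = g₂ a) → |ψ i g₁ - ψ i g₂| ≤ δ := by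
    intro g₁ g₂ hg
    have h1 := hψU i g₂ (g₂⁻¹ * g₁) (hFU _ fun a ha => by
      change g₂.symm (g₁ a) = a
      rw [hg ⟨a, hFA ha⟩]
      exact g₂.symm_apply_apply a)
    rwa [mul_inv_cancel_left] at h1
  rw [StdSimplex.evalAt_map, StdSimplex.evalAt_map]
  have h1 : |p.evalAt (fun Λ => ψ i (hB' (e.comp hC hN Λ))) -
      average hBm hCa p (fun Γ => ψ i (hA' (e.comp hC hN Γ))) Γ₀| ≤ δ := by
    refine p.abs_evalAt_sub_le fun Λ => hclose _ _ fun a => ?_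
    exact (hhB' (e.comp hC hN Λ) (Γ₀.1 a)).trans
      (hhA' (e.comp hC hN (Λ.comp hBm hCa Γ₀)) a).symm
  have h2 : |p.evalAt (fun Λ => ψ i (hB' (e.comp hC hN Λ) * s)) -
      average hBm hCa p (fun Γ => ψ i (hA' (e.comp hC hN Γ))) Γ| ≤ δ := by
    refine p.abs_evalAt_sub_le fun Λ => hclose _ _ fun a => ?_
    have h3 := hhB' (e.comp hC hN Λ) (Γ.1 a)
    refine Eq.trans ?_ (h3.trans (hhA' (e.comp hC hN (Λ.comp hBm hCa Γ)) a).symm)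
    exact congrArg (hB' (e.comp hC hN Λ)) (hΓs a).symm
  -- The bound 3δ is one Ramsey error plus two errors from changing the chosen extension.
  rw [abs_le] at h0 h1 h2 ⊢
  constructor <;> linarith [h0.1, h0.2, h1.1, h1.2, h2.1, h2.2]

end SmoothClass

end FirstOrder.Language

theorem mainTheorem5 {L : FirstOrder.Language.{u, v}} [L.IsRelational]
    [Finite (Σ n, L.Relations n)] (K : FirstOrder.Language.SmoothClass.{u, v, w} L)
    (hAP : K.Amalgamation) (M : Type w) [L.Structure M] (hM : K.IsGeneric M) :
    List.TFAE
      [K.AutConvexRamsey M,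
       K.ConvexRamsey,
       K.ConvexRamseyReal,
       K.ConvexRamseyMulti,
       IsAmenableGroup (M ≃[L] M)] := by
  tfae_have 1 → 2 := hM.convexRamsey
  tfae_have 2 → 3 := fun h => h.convexRamseyReal
  tfae_have 3 → 4 := fun h => h.convexRamseyMulti
  tfae_have 4 → 5 := hM.isAmenableGroup
  tfae_have 5 → 1 := hM.autConvexRamsey
  tfae_finish
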